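/- For a bounded simply connected domain $\Omega\subset\mathbb R^2$ with $C^\infty$-smooth boundary let $\psi\in H^1_0(\Omega)$ be its torsion function, that is, the unique solution of $-\Delta\psi=1$ in $\Omega$, $\psi=0$ on $\partial\Omega$, and put $\mathbf A=\mathbf A_\Omega:=(\partial_2\psi,-\partial_1\psi)$. For $b>0$ define the lowest magnetic Steklov eigenvalue $$\lambda(b,\Omega):=\inf_{u\in H^1(\Omega),\ u|_{\partial\Omega}\neq0}\frac{\|(-i\nabla-b\mathbf A)u\|_{L^2(\Omega;\mathbb C^2)}^2}{\|u|_{\partial\Omega}\|_{L^2(\partial\Omega)}^2},\qquad(1)$$ where $u|_{\partial\Omega}$ is the trace of the complex-valued function $u$ on $\partial\Omega$. Let $I_0,I_1$ be the modified Bessel functions of the first kind. **Proposition.** Let $b,R>0$ and let $\mathcal B\subset\mathbb R^2$ be the disk of radius $R$ centered at the origin, with area $|\mathcal B|$. If $b|\mathcal B|<\pi$, then the infimum (1) for $\Omega=\mathcal B$ is attained on a radial function $u_\star(x)=f_\star(|x|)$, where $f_\star\in C^\infty([0,R])$ is complex-valued and satisfies $$\begin{cases}-f_\star''(r)-\frac1r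 f_\star'(r)+\frac{b^2r^2}{4}f_\star(r)=0&\text{for }0<r<R,\\ f_\star'(R)=\lambda(b,\mathcal B)f_\star(R).\end{cases}$$ Moreover, every such $f_\star$ has the form $$f_\star(r)=A\,I_0\!\left(\frac{br^2}{4}\right)\quad(0\le r\le R)\quad\text{for some }A\in\mathbb C\setminus\{0\},$$ and $$\lambda(b,\mathcal B)=\frac{bR}{2}\,\frac{I_1\left(\frac{bR^2}{4}\right)}{I_0\left(\frac{bR^2}{4}\right)}.$$ -/

import Mathlib

open MeasureTheory Filter Topology
open scoped ContDiff

namespace MagSteklov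

/-- The Euclidean plane. -/
abbrev Plane : Type := EuclideanSpace ℝ (Fin 2)

/-- The modified Bessel function of the first kind `I_n`, for an integer order `n ≥ 0`, given by
its (everywhere convergent) power series. -/
noncomputable def besselI (n : ℕ) (x : ℝ) : ℝ :=
  ∑' k : ℕ, (x / 2) ^ (2 * k + n) / ((Nat.factorial k : ℝ) * (Nat.factorial (k + n) : ℝ))

section Sobolev

variable {𝕜 : Type} [RCLike 𝕜]

/-- The classical gradient `(∂₁ φ, ∂₂ φ)` of a real- or complex-valued function on the plane. -/
noncomputable def grad (φ : Plane → 𝕜) (x : Plane) : EuclideanSpace 𝕜 (Fin 2) :=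
  WithLp.toLp 2 fun j => fderiv ℝ φ x (EuclideanSpace.single j 1)

/-- `φ ∈ C_0^∞(Ω)`. -/
def IsTestFunction (Ω : Set Plane) (φ : Plane → 𝕜) : Prop :=
  ContDiff ℝ ∞ φ ∧ HasCompactSupport φ ∧ tsupport φ ⊆ Ω

/-- `G` is the weak (distributional) gradient of `u` on `Ω`. -/
def IsWeakGradient (Ω : Set Plane) (u : Plane → 𝕜) (G : Plane → EuclideanSpace 𝕜 (Fin 2)) : Prop :=
  ∀ φ : Plane → ℝ, IsTestFunction Ω φ → ∀ j : Fin 2,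
    ∫ x in Ω, (grad φ x j) • u x = -∫ x in Ω, φ x • G x j

/-- `u ∈ H¹(Ω)`, with weak gradient `G` (which is determined by `u` almost everywhere on `Ω`). -/
def MemH1 (Ω : Set Plane) (u : Plane → 𝕜) (G : Plane → EuclideanSpace 𝕜 (Fin 2)) : Prop :=
  MemLp u 2 (volume.restrict Ω) ∧ MemLp G 2 (volume.restrict Ω) ∧ IsWeakGradient Ω u G

/-- The differentiable functions `φ n` converge in the norm of `H¹(Ω)` to the function `u` with
weak gradient `G`. -/
def TendstoH1 (Ω : Set Plane) (φ : ℕ → Plane → 𝕜) (u : Plane → 𝕜)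
    (G : Plane → EuclideanSpace 𝕜 (Fin 2)) : Prop :=
  Tendsto (fun n => eLpNorm (fun x => φ n x - u x) 2 (volume.restrict Ω)) atTop (𝓝 0) ∧
  Tendsto (fun n => eLpNorm (fun x => grad (φ n) x - G x) 2 (volume.restrict Ω)) atTop (𝓝 0)

/-- `u ∈ H¹₀(Ω)`, the closure of `C_0^∞(Ω)` in `H¹(Ω)`; the weak gradient of `u` is `G`. -/
def MemH10 (Ω : Set Plane) (u : Plane → 𝕜) (G : Plane → EuclideanSpace 𝕜 (Fin 2)) : Prop :=
  MemH1 Ω u G ∧ ∃ φ : ℕ → Plane → 𝕜, (∀ n, IsTestFunction Ω (φ n)) ∧ TendstoH1 Ω φ u G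

end Sobolev

/-- The arc length (one-dimensional Hausdorff) measure on the boundary of `Ω`. -/
noncomputable def boundaryMeasure (Ω : Set Plane) : Measure Plane :=
  (μH[1] : Measure Plane).restrict (frontier Ω)

/-- `g ∈ L²(∂Ω)` is the trace on `∂Ω` of the function `u ∈ H¹(Ω)` with weak gradient `G`, for a
bounded domain `Ω` with smooth boundary. The trace operator is the continuous extension to `H¹(Ω)`
of the restriction to `∂Ω` of functions that are smooth up to the boundary. -/
def IsTrace (Ω : Set Plane) (u : Plane → ℂ) (G : Plane → EuclideanSpace ℂ (Fin 2))
    (g : Plane → ℂ) : Prop :=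
  MemLp g 2 (boundaryMeasure Ω) ∧
  ∃ φ : ℕ → Plane → ℂ, (∀ n, ContDiff ℝ ∞ (φ n)) ∧ TendstoH1 Ω φ u G ∧
    Tendsto (fun n => eLpNorm (fun x => φ n x - g x) 2 (boundaryMeasure Ω)) atTop (𝓝 0)

/-- `ψ ∈ H¹₀(Ω)`, with weak gradient `G`, solves `-Δψ = 1` in the sense of distributions on `Ω`,
that is, `ψ` is the torsion function of `Ω`. -/
def IsTorsionFunction (Ω : Set Plane) (ψ : Plane → ℝ) (G : Plane → Plane) : Prop :=
  MemH10 Ω ψ G ∧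
  ∀ φ : Plane → ℝ, IsTestFunction Ω φ → ∫ x in Ω, inner ℝ (G x) (grad φ x) = ∫ x in Ω, φ x

/-- The torsion function of `Ω` together with its weak gradient. It exists and is unique (almost
everywhere on `Ω`) for every bounded open set `Ω`. -/
noncomputable def torsion (Ω : Set Plane) : (Plane → ℝ) × (Plane → Plane) :=
  Classical.epsilon fun p => IsTorsionFunction Ω p.1 p.2

/-- The vector potential `A_Ω = (∂₂ψ, -∂₁ψ)`, where `ψ` is the torsion function of `Ω`. -/
noncomputable def vectorPotential (Ω : Set Plane) (x : Plane) : Plane :=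
  !₂[(torsion Ω).2 x 1, -(torsion Ω).2 x 0]

/-- The magnetic gradient `(-i∇ - b A_Ω) u` of a function `u` with weak gradient `G`. -/
noncomputable def magneticGradient (b : ℝ) (Ω : Set Plane) (u : Plane → ℂ)
    (G : Plane → EuclideanSpace ℂ (Fin 2)) (x : Plane) : EuclideanSpace ℂ (Fin 2) :=
  WithLp.toLp 2 fun j => -Complex.I * G x j - (b : ℂ) * (vectorPotential Ω x j : ℂ) * u x

/-- The magnetic Rayleigh quotient
`‖(-i∇ - b A_Ω) u‖² / ‖g‖²` (norms of `L²(Ω; ℂ²)` and `L²(∂Ω)`) of a function `u` with weak gradient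
`G` and trace `g`. -/
noncomputable def rayleighQuotient (b : ℝ) (Ω : Set Plane) (u : Plane → ℂ)
    (G : Plane → EuclideanSpace ℂ (Fin 2)) (g : Plane → ℂ) : ℝ :=
  (∫ x in Ω, ‖magneticGradient b Ω u G x‖ ^ 2) / ∫ x, ‖g x‖ ^ 2 ∂(boundaryMeasure Ω)

/-- `u ∈ H¹(Ω)`, with weak gradient `G` and trace `g`, where `g ≠ 0` as an element of `L²(∂Ω)`. -/
def IsAdmissible (Ω : Set Plane) (u : Plane → ℂ) (G : Plane → EuclideanSpace ℂ (Fin 2))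
    (g : Plane → ℂ) : Prop :=
  MemH1 Ω u G ∧ IsTrace Ω u G g ∧ ¬ g =ᵐ[boundaryMeasure Ω] 0

/-- The lowest magnetic Steklov eigenvalue `λ(b, Ω)`: the infimum of the magnetic Rayleigh quotient
over all `u ∈ H¹(Ω)` with non-zero trace. -/
noncomputable def steklovEigenvalue (b : ℝ) (Ω : Set Plane) : ℝ :=
  sInf {q : ℝ | ∃ u G g, IsAdmissible Ω u G g ∧ q = rayleighQuotient b Ω u G g}

/-- `u ∈ H¹(Ω)` has non-zero trace and the infimum defining `λ(b, Ω)` is attained at `u`. -/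
def IsGroundState (b : ℝ) (Ω : Set Plane) (u : Plane → ℂ) : Prop :=
  ∃ G g, IsAdmissible Ω u G g ∧ rayleighQuotient b Ω u G g = steklovEigenvalue b Ω

/-- `f ∈ C^∞([0, R])` satisfies
`-f'' - f' / r + (b² r² / 4) f = 0` for `0 < r < R` and `f'(R) = μ f(R)`. -/
def SolvesRadialProblem (b R μ : ℝ) (f : ℝ → ℂ) : Prop :=
  ContDiffOn ℝ ∞ f (Set.Icc 0 R) ∧
  (∀ r ∈ Set.Ioo 0 R,
    -deriv (deriv f) r - (1 / (r : ℂ)) * deriv f r + ((b : ℂ) ^ 2 * (r : ℂ) ^ 2 / 4) * f r = 0) ∧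
  derivWithin f (Set.Icc 0 R) R = (μ : ℂ) * f R

end MagSteklov

/-! The torsion function of the disk is (R² - |x|²)/4, so the potential is A = (-x₂, x₁)/2, which is
purely tangential. In polar coordinates the magnetic energy density is |∂_r u|² + r⁻² |(-i∂_θ -
br²/2) u|². On the n-th angular mode the second term has the factor (n - br²/2)². The flux condition
b|B| < π says bR² < 1, hence br²/2 ≤ 1/2 on the whole disk and n = 0 is optimal at every radius
(`integral_sq_le_of_periodic`). The energy is therefore at least ∫∫ (r|∂_r u|² + b²r³/4 |u|²) dr dθ.

On each ray this is minimised by completing a square. The profile w(r) = I₀(br²/4) is positive and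
solves (r w')' = (b²r³/4) w, so with h = w'/w the integrand equals (r h |u|²)' + r |∂_r u - h u|²
(`integral_radial_eq`). Since arc length is R dθ, this gives energy ≥ (w'(R)/w(R)) ‖u‖² on the
boundary circle, with equality for u = w(|x|). The inequality is shown for smooth functions
(`diskEigenvalue_mul_integral_le`) and passes to H¹ and its traces by approximation
(`diskEigenvalue_mul_le_of_isTrace`).

For the form of all radial minimisers, the weighted Wronskian r(f'w - fw') of a solution f is
constant and vanishes at r = 0, so f/w is constant (`SolvesRadialProblem.eq_mul_profile`). The
constant is nonzero because a function vanishing on the disk has quotient 0, while the eigenvalue is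
positive. -/

namespace MagSteklov

/-! ### Modified Bessel functions -/

/-- The entire function `J_n` with `I_n(x) = (x / 2) ^ n * J_n(x² / 4)`. -/
noncomputable def besselSeries (n : ℕ) (t : ℝ) : ℝ :=
  ∑' k : ℕ, t ^ k / ((Nat.factorial k : ℝ) * (Nat.factorial (k + n) : ℝ))

theorem norm_besselSeries_term_le (n k : ℕ) (t : ℝ) :
    ‖t ^ k / ((Nat.factorial k : ℝ) * (Nat.factorial (k + n) : ℝ))‖ ≤
      |t| ^ k / (Nat.factorial k : ℝ) := by
  have h0 : (0 : ℝ) < (Nat.factorial k : ℝ) * (Nat.factorial (k + n) : ℝ) := by positivity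
  rw [norm_div, norm_pow, Real.norm_eq_abs, Real.norm_eq_abs, abs_of_pos h0]
  have h1 : (1 : ℝ) ≤ (Nat.factorial (k + n) : ℝ) := by
    exact_mod_cast Nat.one_le_iff_ne_zero.2 (Nat.factorial_ne_zero _)
  exact div_le_div_of_nonneg_left (by positivity) (by positivity)
    (le_mul_of_one_le_right (by positivity) h1)

theorem summable_besselSeries (n : ℕ) (t : ℝ) :
    Summable fun k : ℕ => t ^ k / ((Nat.factorial k : ℝ) * (Nat.factorial (k + n) : ℝ)) :=
  Summable.of_norm_bounded (Real.summable_pow_div_factorial |t|)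
    fun k => norm_besselSeries_term_le n k t

theorem summable_mul_pow_div_factorial (M : ℝ) :
    Summable fun k : ℕ => (k : ℝ) * M ^ (k - 1) / (Nat.factorial k : ℝ) := by
  have h : Summable fun k : ℕ =>
      ((k + 1 : ℕ) : ℝ) * M ^ (k + 1 - 1) / (Nat.factorial (k + 1) : ℝ) := by
    refine (Real.summable_pow_div_factorial M).congr fun k => ?_
    rw [Nat.factorial_succ, Nat.add_sub_cancel, Nat.cast_mul,
      mul_div_mul_left _ _ (by positivity)]
  exact (summable_nat_add_iff
    (f := fun k : ℕ => (k : ℝ) * M ^ (k - 1) / (Nat.factorial k : ℝ)) 1).1 h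

/-- Termwise differentiation: k/k! = 1/(k-1)! and k + n = (k-1) + (n+1), so the derivative only
shifts the order. Uniform convergence on the ball of radius M = |t| + 1 comes from the majorant k
M^(k-1)/k!. -/
theorem hasDerivAt_besselSeries (n : ℕ) (t : ℝ) :
    HasDerivAt (besselSeries n) (besselSeries (n + 1) t) t := by
  set M : ℝ := |t| + 1
  have hM : 0 < M := by positivity
  have key : HasDerivAt (besselSeries n)
      (∑' k : ℕ, (k : ℝ) * t ^ (k - 1) /
        ((Nat.factorial k : ℝ) * (Nat.factorial (k + n) : ℝ))) t := by
    have h := hasDerivAt_tsum_of_isPreconnected (t := Metric.ball (0 : ℝ) M) (y₀ := 0) (y := t)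
      (g := fun (k : ℕ) (y : ℝ) => y ^ k / ((Nat.factorial k : ℝ) * (Nat.factorial (k + n) : ℝ)))
      (g' := fun (k : ℕ) (y : ℝ) =>
        (k : ℝ) * y ^ (k - 1) / ((Nat.factorial k : ℝ) * (Nat.factorial (k + n) : ℝ)))
      (summable_mul_pow_div_factorial M) Metric.isOpen_ball (convex_ball 0 M).isPreconnected
    refine h ?_ ?_ (Metric.mem_ball_self hM) (summable_besselSeries n 0) ?_
    · intro k y _
      exact (hasDerivAt_pow k y).div_const _
    · intro k y hy
      have hy' : |y| ≤ M := by simpa using (Metric.mem_ball.1 hy).le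
      have h0 : (0 : ℝ) < (Nat.factorial k : ℝ) * (Nat.factorial (k + n) : ℝ) := by positivity
      rw [norm_div, norm_mul, norm_pow, Real.norm_eq_abs, Real.norm_eq_abs, Real.norm_eq_abs,
        abs_of_nonneg (Nat.cast_nonneg k), abs_of_pos h0]
      have h1 : (1 : ℝ) ≤ (Nat.factorial (k + n) : ℝ) := by
        exact_mod_cast Nat.one_le_iff_ne_zero.2 (Nat.factorial_ne_zero _)
      refine div_le_div₀ (by positivity) ?_ (by positivity)
        (le_mul_of_one_le_right (by positivity) h1)
      gcongr
    · simp [M]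
  convert key using 1
  have hs : Summable fun k : ℕ => ((k + 1 : ℕ) : ℝ) * t ^ (k + 1 - 1) /
      ((Nat.factorial (k + 1) : ℝ) * (Nat.factorial (k + 1 + n) : ℝ)) := by
    refine (summable_besselSeries (n + 1) t).congr fun k => ?_
    rw [Nat.factorial_succ k, Nat.add_sub_cancel, show k + (n + 1) = k + 1 + n by ring]
    push_cast
    field_simp
  rw [((summable_nat_add_iff (f := fun k : ℕ => (k : ℝ) * t ^ (k - 1) /
      ((Nat.factorial k : ℝ) * (Nat.factorial (k + n) : ℝ))) 1).1 hs).tsum_eq_zero_add]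
  simp only [Nat.cast_zero, zero_mul, zero_div, zero_add]
  refine tsum_congr fun k => ?_
  rw [Nat.factorial_succ k, Nat.add_sub_cancel, show k + (n + 1) = k + 1 + n by ring]
  push_cast
  field_simp

theorem contDiff_besselSeries (n : ℕ) : ContDiff ℝ ∞ (besselSeries n) := by
  rw [contDiff_infty]
  intro m
  induction m generalizing n with
  | zero =>
    exact contDiff_zero.2
      (continuous_iff_continuousAt.2 fun t => (hasDerivAt_besselSeries n t).continuousAt)
  | succ m ih =>
    have hd : deriv (besselSeries n) = besselSeries (n + 1) :=
      funext fun t => (hasDerivAt_besselSeries n t).deriv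
    rw [Nat.cast_add, Nat.cast_one, contDiff_succ_iff_deriv, hd]
    exact ⟨fun t => (hasDerivAt_besselSeries n t).differentiableAt, by simp, ih (n + 1)⟩

/-- This is I₀ - I₂ = (2/x) I₁ with the powers of x/2 removed. On coefficients of t^(k+1) it reads
1/((k+1)!(k+2)!) + 1/(k!(k+2)!) = 1/((k+1)!)². -/
theorem besselSeries_recurrence (t : ℝ) :
    besselSeries 1 t + t * besselSeries 2 t = besselSeries 0 t := by
  unfold besselSeries
  rw [(summable_besselSeries 0 t).tsum_eq_zero_add, (summable_besselSeries 1 t).tsum_eq_zero_add,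
    ← tsum_mul_left, add_assoc,
    ← Summable.tsum_add ((summable_nat_add_iff 1).2 (summable_besselSeries 1 t))
      ((summable_besselSeries 2 t).mul_left t)]
  congr 1
  refine tsum_congr fun k => ?_
  · rw [show k + 1 + 1 = k + 2 by ring, add_zero, Nat.factorial_succ (k + 1), Nat.factorial_succ k]
    push_cast
    field_simp
    ring

theorem besselI_eq (n : ℕ) (x : ℝ) :
    besselI n x = (x / 2) ^ n * besselSeries n (x ^ 2 / 4) := by
  unfold besselI besselSeries
  rw [← tsum_mul_left]
  refine tsum_congr fun k => ?_
  rw [pow_add, pow_mul, show (x / 2) ^ 2 = x ^ 2 / 4 by ring]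
  ring

theorem besselSeries_pos (n : ℕ) {t : ℝ} (ht : 0 ≤ t) : 0 < besselSeries n t := by
  refine (summable_besselSeries n t).tsum_pos (fun k => by positivity) 0 ?_
  simp only [pow_zero]
  positivity

/-! ### The radial profile and its differential equation. -/

/-- The radial profile `I_0(b r² / 4)`. -/
noncomputable def profile (b r : ℝ) : ℝ := besselSeries 0 (b ^ 2 * r ^ 4 / 64)

/-- The derivative of `I_0(b r² / 4)` with respect to `r`. -/
noncomputable def profileDeriv (b r : ℝ) : ℝ :=
  b ^ 2 * r ^ 3 / 16 * besselSeries 1 (b ^ 2 * r ^ 4 / 64)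

theorem profile_eq (b r : ℝ) : profile b r = besselI 0 (b * r ^ 2 / 4) := by
  rw [besselI_eq, profile, pow_zero, one_mul]
  congr 1
  ring

theorem profileDeriv_eq (b r : ℝ) :
    profileDeriv b r = b * r / 2 * besselI 1 (b * r ^ 2 / 4) := by
  rw [besselI_eq, profileDeriv,
    show (b * r ^ 2 / 4) ^ 2 / 4 = b ^ 2 * r ^ 4 / 64 by ring]
  ring

theorem profile_pos (b r : ℝ) : 0 < profile b r := besselSeries_pos 0 (by positivity)

theorem profileDeriv_pos {b r : ℝ} (hb : 0 < b) (hr : 0 < r) : 0 < profileDeriv b r :=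
  mul_pos (by positivity) (besselSeries_pos 1 (by positivity))

theorem hasDerivAt_profile (b r : ℝ) : HasDerivAt (profile b) (profileDeriv b r) r := by
  have h : HasDerivAt (fun r : ℝ => b ^ 2 * r ^ 4 / 64) (b ^ 2 * (4 * r ^ 3) / 64) r := by
    simpa using ((hasDerivAt_pow 4 r).const_mul (b ^ 2)).div_const 64
  have := (hasDerivAt_besselSeries 0 (b ^ 2 * r ^ 4 / 64)).comp r h
  refine this.congr_deriv ?_
  rw [profileDeriv]
  ring

/-- The radial equation in divergence form, (r w')' = (b²r³/4) w. With s = b²r⁴/64 one has r w' = 4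
s J₁(s), and (s J₁)' = J₁ + s J₂ = J₀ by the recurrence. -/
theorem hasDerivAt_mul_profileDeriv (b r : ℝ) :
    HasDerivAt (fun r => r * profileDeriv b r) (b ^ 2 * r ^ 3 / 4 * profile b r) r := by
  have h : HasDerivAt (fun r : ℝ => b ^ 2 * r ^ 4 / 64) (b ^ 2 * (4 * r ^ 3) / 64) r := by
    simpa using ((hasDerivAt_pow 4 r).const_mul (b ^ 2)).div_const 64
  have h1 := (hasDerivAt_besselSeries 1 (b ^ 2 * r ^ 4 / 64)).comp r h
  have h2 : HasDerivAt (fun r : ℝ => b ^ 2 * r ^ 4 / 16) (b ^ 2 * (4 * r ^ 3) / 16) r := by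
    simpa using ((hasDerivAt_pow 4 r).const_mul (b ^ 2)).div_const 16
  have h3 := h2.mul h1
  have hfun : (fun r => r * profileDeriv b r) =
      (fun r : ℝ => b ^ 2 * r ^ 4 / 16) * (besselSeries 1 ∘ fun r => b ^ 2 * r ^ 4 / 64) := by
    funext s
    simp only [Pi.mul_apply, Function.comp_apply, profileDeriv]
    ring
  rw [hfun]
  refine h3.congr_deriv ?_
  have := besselSeries_recurrence (b ^ 2 * r ^ 4 / 64)
  rw [profile, ← this]
  simp only [Function.comp_apply]
  ring

theorem contDiff_profile (b : ℝ) : ContDiff ℝ ∞ (profile b) := by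
  unfold profile
  exact (contDiff_besselSeries 0).comp (by fun_prop)

theorem contDiff_profileDeriv (b : ℝ) : ContDiff ℝ ∞ (profileDeriv b) := by
  unfold profileDeriv
  exact ContDiff.mul (by fun_prop) ((contDiff_besselSeries 1).comp (by fun_prop))

/-- Smoothness at the origin holds because the profile depends on r only through r⁴ = (‖x‖²)². -/
theorem contDiff_profile_norm (b : ℝ) : ContDiff ℝ ∞ fun x : Plane => profile b ‖x‖ := by
  have : (fun x : Plane => profile b ‖x‖) =
      fun x : Plane => besselSeries 0 (b ^ 2 * (‖x‖ ^ 2) ^ 2 / 64) := by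
    funext x
    rw [profile, ← pow_mul]
  rw [this]
  refine (contDiff_besselSeries 0).comp ?_
  exact (contDiff_const.mul ((contDiff_norm_sq ℝ).pow 2)).div_const _

/-! ### Polar coordinates and the arc length of a circle -/

/-- The point of the plane with polar coordinates `(r, θ)`. -/
noncomputable def polarPoint (r θ : ℝ) : Plane := !₂[r * Real.cos θ, r * Real.sin θ]

@[simp] theorem polarPoint_apply_zero (r θ : ℝ) : polarPoint r θ 0 = r * Real.cos θ := rfl

@[simp] theorem polarPoint_apply_one (r θ : ℝ) : polarPoint r θ 1 = r * Real.sin θ := rfl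

theorem norm_polarPoint {r : ℝ} (hr : 0 ≤ r) (θ : ℝ) : ‖polarPoint r θ‖ = r := by
  rw [EuclideanSpace.norm_eq, Fin.sum_univ_two, polarPoint_apply_zero, polarPoint_apply_one,
    Real.norm_eq_abs, Real.norm_eq_abs, sq_abs, sq_abs,
    show (r * Real.cos θ) ^ 2 + (r * Real.sin θ) ^ 2 =
      r ^ 2 * (Real.sin θ ^ 2 + Real.cos θ ^ 2) by ring,
    Real.sin_sq_add_cos_sq, mul_one, Real.sqrt_sq hr]

theorem continuous_polarPoint : Continuous fun p : ℝ × ℝ => polarPoint p.1 p.2 := by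
  unfold polarPoint
  refine (PiLp.continuous_toLp 2 _).comp (continuous_pi fun i => ?_)
  fin_cases i
  · exact continuous_fst.mul (Real.continuous_cos.comp continuous_snd)
  · exact continuous_fst.mul (Real.continuous_sin.comp continuous_snd)

theorem dist_polarPoint {R : ℝ} (hR : 0 ≤ R) (s t : ℝ) :
    dist (polarPoint R s) (polarPoint R t) = 2 * R * |Real.sin ((s - t) / 2)| := by
  rw [EuclideanSpace.dist_eq, Fin.sum_univ_two, Real.dist_eq, Real.dist_eq, sq_abs, sq_abs]
  simp only [polarPoint_apply_zero, polarPoint_apply_one]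
  rw [← abs_of_nonneg (show 0 ≤ 2 * R by positivity), ← abs_mul, ← Real.sqrt_sq_eq_abs]
  congr 1
  have h1 : Real.cos (s - t) = 1 - 2 * Real.sin ((s - t) / 2) ^ 2 := by
    have := Real.cos_two_mul' ((s - t) / 2)
    have h2 := Real.sin_sq_add_cos_sq ((s - t) / 2)
    rw [show 2 * ((s - t) / 2) = s - t by ring] at this
    linarith
  rw [Real.cos_sub] at h1
  have hs := Real.sin_sq_add_cos_sq s
  have ht := Real.sin_sq_add_cos_sq t
  linear_combination R ^ 2 * hs + R ^ 2 * ht - 2 * R ^ 2 * h1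

theorem lipschitzWith_polarPoint {R : ℝ} (hR : 0 ≤ R) :
    LipschitzWith (Real.toNNReal R) (polarPoint R) := by
  refine LipschitzWith.of_dist_le_mul fun s t => ?_
  rw [dist_polarPoint hR, Real.coe_toNNReal R hR, Real.dist_eq]
  have h : |Real.sin ((s - t) / 2)| ≤ |(s - t) / 2| := Real.abs_sin_le_abs
  rw [abs_div, abs_two] at h
  nlinarith

theorem exists_abs_le_mul_abs_sin {K : ℝ} (hK : 1 < K) :
    ∃ δ > 0, ∀ x : ℝ, |x| ≤ δ → |x| ≤ K * |Real.sin x| := by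
  have hpos : 0 < 1 - K⁻¹ := by
    have := inv_lt_one_of_one_lt₀ hK
    linarith
  -- The cubic lower bound for the sine gives y(1 - y) ≤ sin y for 0 < y ≤ 1, and K(1 - y) ≥ 1
  -- exactly when y ≤ 1 - 1/K.
  refine ⟨min 1 (1 - K⁻¹), by positivity, fun x hx => ?_⟩
  have key : ∀ y : ℝ, 0 < y → y ≤ min 1 (1 - K⁻¹) → y ≤ K * Real.sin y := by
    intro y hy hyδ
    have h1 : y ≤ 1 := hyδ.trans (min_le_left _ _)
    have h2 : y ≤ 1 - K⁻¹ := hyδ.trans (min_le_right _ _)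
    have h3 := Real.sin_gt_sub_cube hy
    have h4 : K * (1 - y) ≥ 1 := by
      have : K * K⁻¹ = 1 := mul_inv_cancel₀ (by linarith)
      nlinarith
    have h5 : y * (1 - y) ≤ Real.sin y := by nlinarith [mul_pos hy hy]
    nlinarith [mul_le_mul_of_nonneg_left h5 (by linarith : (0 : ℝ) ≤ K)]
  rcases lt_trichotomy x 0 with h | h | h
  · rw [abs_of_neg h] at hx ⊢
    have h6 := key (-x) (by linarith) hx
    rw [Real.sin_neg] at h6
    exact h6.trans (by gcongr; exact neg_le_abs _)
  · simp [h]
  · rw [abs_of_pos h] at hx ⊢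
    exact (key x h hx).trans (by gcongr; exact le_abs_self _)

theorem exists_polarPoint_eq (x : Plane) :
    ∃ θ ∈ Set.Ioc (-Real.pi) Real.pi, polarPoint ‖x‖ θ = x := by
  have hn : ‖(⟨x 0, x 1⟩ : ℂ)‖ = ‖x‖ := by
    rw [EuclideanSpace.norm_eq, Complex.norm_eq_sqrt_sq_add_sq, Fin.sum_univ_two]
    simp
  refine ⟨Complex.arg ⟨x 0, x 1⟩, Complex.arg_mem_Ioc _, ?_⟩
  have h0 := Complex.norm_mul_cos_arg (⟨x 0, x 1⟩ : ℂ)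
  have h1 := Complex.norm_mul_sin_arg (⟨x 0, x 1⟩ : ℂ)
  rw [hn] at h0 h1
  ext i
  fin_cases i
  · exact h0
  · exact h1

theorem injOn_polarPoint {R : ℝ} (hR : 0 < R) :
    Set.InjOn (polarPoint R) (Set.Ioc (-Real.pi) Real.pi) := by
  intro s hs t ht hst
  have h : 2 * R * |Real.sin ((s - t) / 2)| = 0 := by
    rw [← dist_polarPoint hR.le, hst, dist_self]
  have h2 : Real.sin ((s - t) / 2) = 0 := by
    rcases mul_eq_zero.1 h with h | h
    · linarith
    · exact abs_eq_zero.1 h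
  have := (Real.sin_eq_zero_iff_of_lt_of_lt (x := (s - t) / 2)
    (by linarith [hs.1, hs.2, ht.1, ht.2]) (by linarith [hs.1, hs.2, ht.1, ht.2])).1 h2
  linarith

/-- On a short arc, chord and arc are comparable up to the factor K, so the inverse parametrisation
is Lipschitz with constant K/R; Lipschitz maps control Hausdorff measure. -/
theorem volume_le_of_subset_Ioc {R K δ a : ℝ} (hR : 0 < R) (hK : 0 < K)
    (hδ : ∀ x : ℝ, |x| ≤ δ → |x| ≤ K * |Real.sin x|) {S : Set ℝ}
    (hS : S ⊆ Set.Ioc a (a + δ)) :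
    ENNReal.ofReal R * volume S ≤ ENNReal.ofReal K * μH[1] (polarPoint R '' S) := by
  have hle : ∀ s ∈ S, ∀ t ∈ S,
      dist s t ≤ K / R * dist (polarPoint R s) (polarPoint R t) := by
    intro s hs t ht
    have h1 := hS hs
    have h2 := hS ht
    have h3 : |(s - t) / 2| ≤ δ := by
      rw [abs_le]
      constructor <;> linarith [h1.1, h1.2, h2.1, h2.2]
    have h4 := hδ _ h3
    rw [dist_polarPoint hR.le, Real.dist_eq]
    rw [abs_div, abs_two] at h4
    have : K / R * (2 * R * |Real.sin ((s - t) / 2)|) = 2 * (K * |Real.sin ((s - t) / 2)|) := by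
      field_simp
    rw [this]
    linarith
  have hinj : Set.InjOn (polarPoint R) S := by
    intro s hs t ht hst
    have := hle s hs t ht
    rw [hst, dist_self, mul_zero] at this
    exact dist_le_zero.1 this
  have hinv := hinj.leftInvOn_invFunOn
  set g := Function.invFunOn (polarPoint R) S
  have hlip : LipschitzOnWith (Real.toNNReal (K / R)) g (polarPoint R '' S) := by
    refine LipschitzOnWith.of_dist_le_mul ?_
    rintro _ ⟨s, hs, rfl⟩ _ ⟨t, ht, rfl⟩
    rw [hinv hs, hinv ht, Real.coe_toNNReal _ (by positivity)]
    exact hle s hs t ht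
  have h := hlip.hausdorffMeasure_image_le (d := 1) zero_le_one
  rw [hinv.image_image, hausdorffMeasure_real, ENNReal.rpow_one] at h
  calc ENNReal.ofReal R * volume S
      ≤ ENNReal.ofReal R * (ENNReal.ofReal (K / R) * μH[1] (polarPoint R '' S)) := by
        gcongr
        exact h
    _ = ENNReal.ofReal K * μH[1] (polarPoint R '' S) := by
        rw [← mul_assoc, ← ENNReal.ofReal_mul hR.le, mul_div_cancel₀ _ hR.ne']

/-- The upper bound is the Lipschitz bound for the parametrisation. For the lower bound, `S` is cut
into pieces of length at most δ, whose images are disjoint; the estimate on short arcs is summed and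
then K tends to 1. -/
theorem hausdorffMeasure_image_polarPoint {R : ℝ} (hR : 0 < R) {S : Set ℝ}
    (hS : MeasurableSet S) (hsub : S ⊆ Set.Ioc (-Real.pi) Real.pi) :
    μH[1] (polarPoint R '' S) = ENNReal.ofReal R * volume S := by
  refine le_antisymm ?_ ?_
  · have h := ((lipschitzWith_polarPoint hR.le).lipschitzOnWith (s := S)).hausdorffMeasure_image_le
      (d := 1) zero_le_one
    rwa [hausdorffMeasure_real, ENNReal.rpow_one] at h
  · have key : ∀ K : ℝ, 1 < K →
        ENNReal.ofReal R * volume S ≤ ENNReal.ofReal K * μH[1] (polarPoint R '' S) := by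
      intro K hK
      obtain ⟨δ, hδ0, hδ⟩ := exists_abs_le_mul_abs_sin hK
      set T : ℤ → Set ℝ := fun n => S ∩ Set.Ioc (n • δ) ((n + 1) • δ) with hT
      have hU : S = ⋃ n, T n := by
        rw [← Set.inter_iUnion, iUnion_Ioc_zsmul hδ0, Set.inter_univ]
      have hTm : ∀ n, MeasurableSet (T n) := fun n => hS.inter measurableSet_Ioc
      have hTd : Pairwise (Function.onFun Disjoint T) := fun m n hmn =>
        (Set.pairwise_disjoint_Ioc_zsmul δ hmn).mono Set.inter_subset_right Set.inter_subset_right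
      have hTs : ∀ n, T n ⊆ Set.Ioc (-Real.pi) Real.pi :=
        fun n => Set.inter_subset_left.trans hsub
      have hIm : ∀ n, MeasurableSet (polarPoint R '' T n) := fun n =>
        (hTm n).image_of_continuousOn_injOn (lipschitzWith_polarPoint hR.le).continuous.continuousOn
          ((injOn_polarPoint hR).mono (hTs n))
      have hId : Pairwise (Function.onFun Disjoint fun n => polarPoint R '' T n) := fun m n hmn =>
        (hTd hmn).image (injOn_polarPoint hR) (hTs m) (hTs n)
      conv_lhs => rw [hU]
      conv_rhs => rw [hU]
      rw [Set.image_iUnion, measure_iUnion hTd hTm, measure_iUnion hId hIm, ← ENNReal.tsum_mul_left,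
        ← ENNReal.tsum_mul_left]
      refine ENNReal.tsum_le_tsum fun n => ?_
      refine volume_le_of_subset_Ioc (a := n • δ) hR (by linarith) hδ ?_
      refine Set.inter_subset_right.trans (Set.Ioc_subset_Ioc_right ?_)
      rw [add_smul, one_smul]
    have hlim : Tendsto (fun K : ℝ => ENNReal.ofReal K * μH[1] (polarPoint R '' S)) (𝓝[>] 1)
        (𝓝 (ENNReal.ofReal 1 * μH[1] (polarPoint R '' S))) := by
      refine ENNReal.Tendsto.mul_const ?_ (Or.inl (by simp))
      exact (ENNReal.continuous_ofReal.tendsto 1).mono_left nhdsWithin_le_nhds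
    rw [ENNReal.ofReal_one, one_mul] at hlim
    exact ge_of_tendsto hlim (eventually_nhdsWithin_of_forall fun K hK => key K hK)

theorem boundaryMeasure_ball {R : ℝ} (hR : 0 < R) :
    boundaryMeasure (Metric.ball (0 : Plane) R) =
      ENNReal.ofReal R •
        (volume.restrict (Set.Ioc (-Real.pi) Real.pi)).map (polarPoint R) := by
  have hm : Measurable (polarPoint R) := (lipschitzWith_polarPoint hR.le).continuous.measurable
  rw [boundaryMeasure, frontier_ball _ hR.ne']
  ext E hE
  rw [Measure.restrict_apply hE, Measure.smul_apply, Measure.map_apply hm hE,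
    Measure.restrict_apply (hm hE), smul_eq_mul,
    ← hausdorffMeasure_image_polarPoint hR ((hm hE).inter measurableSet_Ioc)
      Set.inter_subset_right]
  congr 1
  ext x
  constructor
  · rintro ⟨hx, hxs⟩
    have hxR : ‖x‖ = R := by simpa using hxs
    obtain ⟨θ, hθ, hθx⟩ := exists_polarPoint_eq x
    rw [hxR] at hθx
    exact ⟨θ, ⟨by rwa [Set.mem_preimage, hθx], hθ⟩, hθx⟩
  · rintro ⟨θ, ⟨h1, _⟩, rfl⟩
    exact ⟨h1, by simp [norm_polarPoint hR.le]⟩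

theorem isFiniteMeasure_boundaryMeasure_ball {R : ℝ} (hR : 0 < R) :
    IsFiniteMeasure (boundaryMeasure (Metric.ball (0 : Plane) R)) := by
  rw [boundaryMeasure_ball hR]
  exact Measure.smul_finite _ ENNReal.ofReal_ne_top

theorem integral_boundaryMeasure_ball {R : ℝ} (hR : 0 < R) {F : Plane → ℝ} (hF : Continuous F) :
    ∫ x, F x ∂(boundaryMeasure (Metric.ball (0 : Plane) R)) =
      R * ∫ θ in (-Real.pi)..Real.pi, F (polarPoint R θ) := by
  have hm : Measurable (polarPoint R) := (lipschitzWith_polarPoint hR.le).continuous.measurable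
  rw [boundaryMeasure_ball hR, integral_smul_measure, ENNReal.toReal_ofReal hR.le, smul_eq_mul,
    integral_map hm.aemeasurable hF.aestronglyMeasurable,
    intervalIntegral.integral_of_le (neg_le_self Real.pi_pos.le)]

/-! ### Integration over the disk in polar coordinates. -/

theorem integral_plane_eq (F : Plane → ℝ) :
    ∫ x, F x = ∫ p : ℝ × ℝ, F !₂[p.1, p.2] := by
  have e1 := (EuclideanSpace.volume_preserving_symm_measurableEquiv_toLp (Fin 2)).symm
  have e2 := (volume_preserving_finTwoArrow ℝ).symm
  rw [← e1.integral_comp' (g := F),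
    ← e2.integral_comp' (g := fun y => F ((MeasurableEquiv.toLp 2 (Fin 2 → ℝ)).symm.symm y))]
  rfl

theorem integral_ball_polar {R : ℝ} (hR : 0 < R) {F : Plane → ℝ} (hF : Continuous F) :
    ∫ x in Metric.ball (0 : Plane) R, F x =
      ∫ r in (0 : ℝ)..R, ∫ θ in (-Real.pi)..Real.pi, r * F (polarPoint r θ) := by
  rw [← integral_indicator Metric.isOpen_ball.measurableSet, integral_plane_eq,
    ← integral_comp_polarCoord_symm]
  have h1 : ∫ p in polarCoord.target, p.1 •
        (Metric.ball (0 : Plane) R).indicator F !₂[(polarCoord.symm p).1, (polarCoord.symm p).2] =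
      ∫ p in polarCoord.target, (Set.Ioo 0 R ×ˢ Set.univ).indicator
        (fun p : ℝ × ℝ => p.1 * F (polarPoint p.1 p.2)) p := by
    refine setIntegral_congr_fun polarCoord.open_target.measurableSet ?_
    rintro ⟨r, θ⟩ ⟨hr, _⟩
    have hr : 0 < r := hr
    have hp : !₂[(polarCoord.symm (r, θ)).1, (polarCoord.symm (r, θ)).2] = polarPoint r θ := rfl
    simp only [hp]
    by_cases hrR : r < R
    · rw [Set.indicator_of_mem, Set.indicator_of_mem]
      · rfl
      · exact ⟨⟨hr, hrR⟩, Set.mem_univ _⟩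
      · simpa [norm_polarPoint hr.le] using hrR
    · rw [Set.indicator_of_notMem, Set.indicator_of_notMem, smul_zero]
      · exact fun h => hrR h.1.2
      · simpa [norm_polarPoint hr.le] using hrR
  rw [h1, setIntegral_indicator (measurableSet_Ioo.prod MeasurableSet.univ), polarCoord_target,
    Set.prod_inter_prod, Set.inter_univ, Set.inter_eq_right.2 (fun x hx => hx.1),
    Measure.volume_eq_prod,
    setIntegral_prod]
  · rw [intervalIntegral.integral_of_le hR.le, integral_Ioc_eq_integral_Ioo]
    refine setIntegral_congr_fun measurableSet_Ioo fun r _ => ?_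
    simp only
    rw [intervalIntegral.integral_of_le (neg_le_self Real.pi_pos.le), integral_Ioc_eq_integral_Ioo]
  · refine IntegrableOn.mono_set (t := Set.Icc 0 R ×ˢ Set.Icc (-Real.pi) Real.pi) ?_
      (Set.prod_mono Set.Ioo_subset_Icc_self Set.Ioo_subset_Icc_self)
    refine ContinuousOn.integrableOn_compact (isCompact_Icc.prod isCompact_Icc) ?_
    exact (continuous_fst.mul (hF.comp continuous_polarPoint)).continuousOn

/-! ### A spectral inequality on the circle -/

/-- No integer is closer to `a` than 0. This is the point where small flux is needed. -/
theorem le_sq_sub_of_le_half (n : ℤ) {a : ℝ} (h0 : 0 ≤ a) (h1 : a ≤ 1 / 2) :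
    a ^ 2 ≤ ((n : ℝ) - a) ^ 2 := by
  rcases le_or_gt n 0 with hn | hn
  · have : (n : ℝ) ≤ 0 := by exact_mod_cast hn
    nlinarith
  · have : (1 : ℝ) ≤ n := by exact_mod_cast hn
    nlinarith

theorem fourierCoeffOn_deriv_of_periodic {v v' : ℝ → ℂ} (hv : ∀ θ, HasDerivAt v (v' θ) θ)
    (hv' : Continuous v') (hper : v (-Real.pi) = v Real.pi) (n : ℤ) :
    fourierCoeffOn (neg_lt_self Real.pi_pos) v' n =
      Complex.I * n * fourierCoeffOn (neg_lt_self Real.pi_pos) v n := by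
  have hpi : (Real.pi : ℂ) ≠ 0 := by exact_mod_cast Real.pi_ne_zero
  -- The integration-by-parts formula for Fourier coefficients divides by n, so the mean value is
  -- treated separately by the fundamental theorem of calculus.
  rcases eq_or_ne n 0 with rfl | hn
  · rw [fourierCoeffOn_eq_integral]
    have : ∫ θ in (-Real.pi)..Real.pi, v' θ = v Real.pi - v (-Real.pi) :=
      intervalIntegral.integral_eq_sub_of_hasDerivAt (fun θ _ => hv θ)
        (hv'.intervalIntegrable _ _)
    simp [this, hper]
  · have hn' : (n : ℂ) ≠ 0 := by exact_mod_cast hn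
    rw [fourierCoeffOn_of_hasDerivAt (neg_lt_self Real.pi_pos) hn (fun θ _ => hv θ)
      (hv'.intervalIntegrable _ _), hper, sub_self, mul_zero, zero_sub]
    push_cast
    have hI := Complex.I_ne_zero
    field_simp
    ring

theorem hasSum_sq_fourierCoeffOn_of_continuous {f : ℝ → ℂ} (hf : Continuous f) :
    HasSum (fun n => ‖fourierCoeffOn (neg_lt_self Real.pi_pos) f n‖ ^ 2)
      ((Real.pi - -Real.pi)⁻¹ • ∫ θ in (-Real.pi)..Real.pi, ‖f θ‖ ^ 2) := by
  refine hasSum_sq_fourierCoeffOn _ ?_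
  have : MemLp f 2 (volume.restrict (Set.Icc (-Real.pi) Real.pi)) := by
    obtain ⟨C, hC⟩ := isCompact_Icc.exists_bound_of_continuousOn
      (hf.continuousOn (s := Set.Icc (-Real.pi) Real.pi))
    exact MemLp.of_bound hf.aestronglyMeasurable C
      ((ae_restrict_iff' measurableSet_Icc).2 (Eventually.of_forall hC))
  exact this.mono_measure (Measure.restrict_mono Set.Ioc_subset_Icc_self le_rfl)

theorem fourierCoeffOn_linear_comb {f g : ℝ → ℂ} (hf : Continuous f) (hg : Continuous g)
    (c d : ℂ) (n : ℤ) :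
    fourierCoeffOn (neg_lt_self Real.pi_pos) (fun θ => c * f θ - d * g θ) n =
      c * fourierCoeffOn (neg_lt_self Real.pi_pos) f n -
        d * fourierCoeffOn (neg_lt_self Real.pi_pos) g n := by
  simp only [fourierCoeffOn_eq_integral]
  have hF : Continuous fun x : ℝ =>
      (fourier (-n) : AddCircle (Real.pi - -Real.pi) → ℂ) (x : AddCircle (Real.pi - -Real.pi)) :=
    (map_continuous (fourier (-n))).comp (AddCircle.continuous_mk' _)
  have e : ∀ x : ℝ, (fourier (-n) : AddCircle (Real.pi - -Real.pi) → ℂ) x • (c * f x - d * g x) =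
      c * ((fourier (-n) : AddCircle (Real.pi - -Real.pi) → ℂ) x • f x) -
        d * ((fourier (-n) : AddCircle (Real.pi - -Real.pi) → ℂ) x • g x) := by
    intro x
    simp only [smul_eq_mul]
    ring
  simp only [e]
  rw [intervalIntegral.integral_sub, intervalIntegral.integral_const_mul,
    intervalIntegral.integral_const_mul, Complex.real_smul, Complex.real_smul, Complex.real_smul]
  · ring
  · exact (continuous_const.mul (hF.smul hf)).intervalIntegrable _ _
  · exact (continuous_const.mul (hF.smul hg)).intervalIntegrable _ _

/-- The operator `-i ∂_θ` on the circle has no spectrum in the open interval `(0, 2a)` if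
`0 ≤ a ≤ 1/2`. -/
theorem integral_sq_le_of_periodic {v v' : ℝ → ℂ} (hv : ∀ θ, HasDerivAt v (v' θ) θ)
    (hv' : Continuous v') (hper : v (-Real.pi) = v Real.pi) {a : ℝ} (h0 : 0 ≤ a)
    (h1 : a ≤ 1 / 2) :
    a ^ 2 * ∫ θ in (-Real.pi)..Real.pi, ‖v θ‖ ^ 2 ≤
      ∫ θ in (-Real.pi)..Real.pi, ‖-Complex.I * v' θ - a * v θ‖ ^ 2 := by
  have hvc : Continuous v := continuous_iff_continuousAt.2 fun θ => (hv θ).continuousAt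
  have hw : Continuous fun θ => -Complex.I * v' θ - a * v θ := by fun_prop
  -- Parseval on both sides reduces the claim to a² ≤ (n - a)² for each mode.
  have s1 := (hasSum_sq_fourierCoeffOn_of_continuous hvc).mul_left (a ^ 2)
  have s2 := hasSum_sq_fourierCoeffOn_of_continuous hw
  have hle := hasSum_le (fun n => ?_) s1 s2
  · have hpos : 0 < (Real.pi - -Real.pi)⁻¹ := by
      have := Real.pi_pos
      exact inv_pos.2 (by linarith)
    simp only [smul_eq_mul] at hle
    rw [mul_left_comm] at hle
    exact le_of_mul_le_mul_left hle hpos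
  · rw [fourierCoeffOn_linear_comb hv' hvc, fourierCoeffOn_deriv_of_periodic hv hv' hper]
    have e : ∀ z : ℂ, -Complex.I * (Complex.I * n * z) - a * z = (((n : ℝ) - a : ℝ) : ℂ) * z := by
      intro z
      push_cast
      linear_combination -(n * z) * Complex.I_mul_I
    rw [e, norm_mul, mul_pow, Complex.norm_real, Real.norm_eq_abs, sq_abs]
    exact mul_le_mul_of_nonneg_right (le_sq_sub_of_le_half n h0 h1) (by positivity)

/-! ### Weak gradients and the torsion function of a disk -/

section Gradient

variable {𝕜 : Type} [RCLike 𝕜]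

theorem grad_apply (φ : Plane → 𝕜) (x : Plane) (j : Fin 2) :
    grad φ x j = fderiv ℝ φ x (EuclideanSpace.single j 1) := rfl

theorem continuous_grad {φ : Plane → 𝕜} (hφ : ContDiff ℝ 1 φ) : Continuous (grad φ) := by
  unfold grad
  refine (PiLp.continuous_toLp 2 _).comp (continuous_pi fun j => ?_)
  exact (hφ.continuous_fderiv one_ne_zero).clm_apply continuous_const

theorem grad_eq_zero_of_notMem_tsupport {φ : Plane → 𝕜} {x : Plane} (hx : x ∉ tsupport φ) :
    grad φ x = 0 := by
  ext j
  rw [grad_apply, fderiv_of_notMem_tsupport ℝ hx]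
  rfl

theorem hasCompactSupport_grad {φ : Plane → 𝕜} (hφ : HasCompactSupport φ) :
    HasCompactSupport (grad φ) :=
  HasCompactSupport.intro hφ fun _ hx => grad_eq_zero_of_notMem_tsupport hx

/-- Test functions are supported in `Ω`, so both integrals extend to the whole plane, where
integration by parts has no boundary term. -/
theorem isWeakGradient_grad {u : Plane → 𝕜} (hu : ContDiff ℝ 1 u) (Ω : Set Plane) :
    IsWeakGradient Ω u (grad u) := by
  intro φ hφ j
  have hφ1 : ContDiff ℝ 1 φ := hφ.1.of_le (by exact_mod_cast le_top)
  have hout : ∀ x, x ∉ Ω → x ∉ tsupport φ := fun x hx h => hx (hφ.2.2 h)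
  rw [setIntegral_eq_integral_of_forall_compl_eq_zero
      (fun x hx => by simp [grad_eq_zero_of_notMem_tsupport (hout x hx)]),
    setIntegral_eq_integral_of_forall_compl_eq_zero
      (fun x hx => by simp [image_eq_zero_of_notMem_tsupport (hout x hx)])]
  have c1 : Continuous fun x => fderiv ℝ φ x (EuclideanSpace.single j 1) :=
    (hφ1.continuous_fderiv one_ne_zero).clm_apply continuous_const
  have c2 : Continuous fun x => fderiv ℝ u x (EuclideanSpace.single j 1) :=
    (hu.continuous_fderiv one_ne_zero).clm_apply continuous_const
  have k1 : HasCompactSupport fun x => fderiv ℝ φ x (EuclideanSpace.single j 1) :=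
    hφ.2.1.fderiv_apply ℝ _
  have := integral_smul_fderiv_eq_neg_fderiv_smul_of_integrable (μ := volume) (f := φ) (g := u)
    (v := EuclideanSpace.single j 1)
    ((c1.smul hu.continuous).integrable_of_hasCompactSupport k1.smul_right)
    ((hφ1.continuous.smul c2).integrable_of_hasCompactSupport hφ.2.1.smul_right)
    ((hφ1.continuous.smul hu.continuous).integrable_of_hasCompactSupport hφ.2.1.smul_right)
    (fun x _ => hφ1.differentiable one_ne_zero x) (fun x _ => hu.differentiable one_ne_zero x)
  simp only [grad_apply]
  rw [this, neg_neg]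

end Gradient

theorem isFiniteMeasure_restrict_ball (R : ℝ) :
    IsFiniteMeasure (volume.restrict (Metric.ball (0 : Plane) R)) :=
  isFiniteMeasure_restrict.2 measure_ball_lt_top.ne

theorem _root_.Continuous.memLp_restrict_ball {E : Type*} [NormedAddCommGroup E] {F : Plane → E}
    (hF : Continuous F) (p : ENNReal) (R : ℝ) :
    MemLp F p (volume.restrict (Metric.ball (0 : Plane) R)) := by
  obtain ⟨C, hC⟩ := (isCompact_closedBall (0 : Plane) R).exists_bound_of_continuousOn
    hF.continuousOn
  have := isFiniteMeasure_restrict_ball R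
  exact MemLp.of_bound hF.aestronglyMeasurable C ((ae_restrict_iff' measurableSet_ball).2
    (Eventually.of_forall fun x hx => hC x (Metric.ball_subset_closedBall hx)))

theorem tendsto_eLpNorm_two_of_bounded {α E : Type*} [MeasurableSpace α] {μ : Measure α}
    [IsFiniteMeasure μ] [NormedAddCommGroup E] {f : ℕ → α → E} {C : ℝ}
    (hf : ∀ n, AEStronglyMeasurable (f n) μ) (hC : ∀ n, ∀ᵐ x ∂μ, ‖f n x‖ ≤ C)
    (hlim : ∀ᵐ x ∂μ, Tendsto (fun n => f n x) atTop (𝓝 0)) :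
    Tendsto (fun n => eLpNorm (f n) 2 μ) atTop (𝓝 0) := by
  have h2 : ∀ n, eLpNorm (f n) 2 μ = (∫⁻ x, ‖f n x‖ₑ ^ (2 : ℝ) ∂μ) ^ (1 / 2 : ℝ) := fun n => by
    rw [eLpNorm_eq_lintegral_rpow_enorm_toReal two_ne_zero ENNReal.ofNat_ne_top]
    simp
  simp only [h2]
  have hl : Tendsto (fun n => ∫⁻ x, ‖f n x‖ₑ ^ (2 : ℝ) ∂μ) atTop (𝓝 (∫⁻ _, 0 ∂μ)) := by
    refine tendsto_lintegral_of_dominated_convergence' (fun _ => ENNReal.ofReal C ^ (2 : ℝ))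
      (fun n => (hf n).enorm.pow_const _) (fun n => ?_) ?_ ?_
    · filter_upwards [hC n] with x hx
      gcongr
      rw [← ofReal_norm]
      exact ENNReal.ofReal_le_ofReal hx
    · rw [lintegral_const]
      exact ENNReal.mul_ne_top (by simp) (measure_ne_top _ _)
    · filter_upwards [hlim] with x hx
      have := (ENNReal.continuous_rpow_const (y := 2)).tendsto 0 |>.comp
        ((continuous_enorm.tendsto (0 : E)).comp hx |>.trans (by simp))
      simpa [Function.comp_def] using this
  rw [lintegral_zero] at hl
  have := ((ENNReal.continuous_rpow_const (y := 1 / 2)).tendsto 0).comp hl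
  simpa [Function.comp_def] using this

/-! ### The torsion function of the disk. -/

/-- The classical torsion function of the disk of radius `R`. -/
noncomputable def diskTorsion (R : ℝ) (x : Plane) : ℝ := (R ^ 2 - ‖x‖ ^ 2) / 4

theorem contDiff_diskTorsion (R : ℝ) : ContDiff ℝ ∞ (diskTorsion R) :=
  (contDiff_const.sub (contDiff_norm_sq ℝ)).div_const 4

theorem hasFDerivAt_diskTorsion (R : ℝ) (x : Plane) :
    HasFDerivAt (diskTorsion R) (-(1 / 2 : ℝ) • innerSL ℝ x) x := by
  have h := ((hasFDerivAt_const (R ^ 2) x).sub (hasStrictFDerivAt_norm_sq x).hasFDerivAt).mul_const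
    (4⁻¹ : ℝ)
  have e : diskTorsion R = fun y : Plane => (R ^ 2 - ‖y‖ ^ 2) * 4⁻¹ := by
    funext y
    rw [diskTorsion, div_eq_mul_inv]
  rw [e]
  refine h.congr_fderiv ?_
  ext v
  simp
  ring

theorem grad_diskTorsion (R : ℝ) : grad (diskTorsion R) = fun x : Plane => -(1 / 2 : ℝ) • x := by
  funext x
  ext j
  rw [grad_apply, (hasFDerivAt_diskTorsion R x).fderiv]
  simp [EuclideanSpace.inner_single_right]

/-- `smoothCutoff n t` vanishes for `t ≤ 1 / (n + 1)` and equals `t` for `t ≥ 2 / (n + 1)`. -/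
noncomputable def smoothCutoff (n : ℕ) (t : ℝ) : ℝ :=
  t * Real.smoothTransition ((n + 1) * t - 1)

/-- The derivative of `smoothCutoff n` is `smoothCutoffDeriv ((n + 1) * t - 1)`. -/
noncomputable def smoothCutoffDeriv (y : ℝ) : ℝ :=
  Real.smoothTransition y + (y + 1) * deriv Real.smoothTransition y

theorem contDiff_smoothCutoff (n : ℕ) : ContDiff ℝ ∞ (smoothCutoff n) :=
  contDiff_id.mul (Real.smoothTransition.contDiff.comp (by fun_prop))

theorem hasDerivAt_smoothCutoff (n : ℕ) (t : ℝ) :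
    HasDerivAt (smoothCutoff n) (smoothCutoffDeriv ((n + 1) * t - 1)) t := by
  have h1 : HasDerivAt (fun t : ℝ => ((n : ℝ) + 1) * t - 1) (n + 1) t := by
    simpa using ((hasDerivAt_id t).const_mul ((n : ℝ) + 1)).sub_const 1
  have hd : Differentiable ℝ Real.smoothTransition :=
    (Real.smoothTransition.contDiff (n := 1)).differentiable one_ne_zero
  have h2 := (hd (((n : ℝ) + 1) * t - 1)).hasDerivAt.comp t h1
  refine ((hasDerivAt_id t).mul h2).congr_deriv ?_
  simp only [smoothCutoffDeriv, id, Function.comp_apply]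
  ring

theorem continuous_smoothCutoffDeriv : Continuous smoothCutoffDeriv := by
  unfold smoothCutoffDeriv
  have h := (Real.smoothTransition.contDiff (n := 1)).continuous_deriv le_rfl
  exact Real.smoothTransition.continuous.add ((continuous_id.add continuous_const).mul h)

theorem smoothCutoffDeriv_of_neg {y : ℝ} (hy : y < 0) : smoothCutoffDeriv y = 0 := by
  have h : Real.smoothTransition =ᶠ[𝓝 y] fun _ => 0 := by
    filter_upwards [Iio_mem_nhds hy] with z hz
    exact Real.smoothTransition.zero_of_nonpos (le_of_lt hz)
  rw [smoothCutoffDeriv, h.deriv_eq, h.eq_of_nhds]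
  simp

theorem smoothCutoffDeriv_of_one_lt {y : ℝ} (hy : 1 < y) : smoothCutoffDeriv y = 1 := by
  have h : Real.smoothTransition =ᶠ[𝓝 y] fun _ => 1 := by
    filter_upwards [Ioi_mem_nhds hy] with z hz
    exact Real.smoothTransition.one_of_one_le (le_of_lt hz)
  rw [smoothCutoffDeriv, h.deriv_eq, h.eq_of_nhds]
  simp

/-- One bound serves all truncations `smoothCutoff n`, since their derivatives are rescalings of
this single function; it is constant on each side of [0, 1]. -/
theorem exists_abs_smoothCutoffDeriv_le : ∃ C, ∀ y, |smoothCutoffDeriv y| ≤ C := by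
  obtain ⟨C, hC⟩ := (isCompact_Icc (a := (0 : ℝ)) (b := 1)).exists_bound_of_continuousOn
    continuous_smoothCutoffDeriv.continuousOn
  refine ⟨max C 1, fun y => ?_⟩
  rcases lt_or_ge y 0 with h | h
  · simp [smoothCutoffDeriv_of_neg h]
  rcases lt_or_ge 1 y with h' | h'
  · simp [smoothCutoffDeriv_of_one_lt h']
  · exact (hC y ⟨h, h'⟩).trans (le_max_left _ _)

theorem eventually_one_lt_mul_sub {t : ℝ} (ht : 0 < t) :
    ∀ᶠ n : ℕ in atTop, 1 < ((n : ℝ) + 1) * t - 1 := by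
  have h : Tendsto (fun n : ℕ => ((n : ℝ) + 1) * t) atTop atTop :=
    (tendsto_atTop_add_const_right _ 1 tendsto_natCast_atTop_atTop).atTop_mul_const ht
  filter_upwards [h.eventually_gt_atTop 2] with n hn
  linarith

theorem isTestFunction_smoothCutoff {R : ℝ} (hR : 0 < R) (n : ℕ) :
    IsTestFunction (Metric.ball (0 : Plane) R) fun x => smoothCutoff n (diskTorsion R x) := by
  have hcl : IsClosed {x : Plane | 1 / ((n : ℝ) + 1) ≤ diskTorsion R x} :=
    isClosed_le continuous_const (contDiff_diskTorsion R).continuous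
  have hball : {x : Plane | 1 / ((n : ℝ) + 1) ≤ diskTorsion R x} ⊆ Metric.ball 0 R := by
    intro x hx
    have h1 : 0 < diskTorsion R x := lt_of_lt_of_le (by positivity) hx
    rw [mem_ball_zero_iff]
    rw [diskTorsion] at h1
    exact lt_of_pow_lt_pow_left₀ 2 hR.le (by linarith)
  have hsupp : Function.support (fun x => smoothCutoff n (diskTorsion R x)) ⊆
      {x : Plane | 1 / ((n : ℝ) + 1) ≤ diskTorsion R x} := by
    intro x hx
    by_contra hlt
    refine hx ?_
    have h2 : diskTorsion R x < 1 / ((n : ℝ) + 1) := not_le.1 hlt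
    rw [lt_div_iff₀ (by positivity)] at h2
    change smoothCutoff n (diskTorsion R x) = 0
    rw [smoothCutoff, Real.smoothTransition.zero_of_nonpos (by linarith), mul_zero]
  have hcpt : IsCompact {x : Plane | 1 / ((n : ℝ) + 1) ≤ diskTorsion R x} :=
    Metric.isCompact_of_isClosed_isBounded hcl (Metric.isBounded_ball.subset hball)
  exact ⟨(contDiff_smoothCutoff n).comp (contDiff_diskTorsion R),
    HasCompactSupport.of_support_subset_isCompact hcpt hsupp,
    (closure_minimal hsupp hcl).trans hball⟩

theorem grad_smoothCutoff_diskTorsion (R : ℝ) (n : ℕ) (x : Plane) :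
    grad (fun x => smoothCutoff n (diskTorsion R x)) x =
      smoothCutoffDeriv ((n + 1) * diskTorsion R x - 1) • grad (diskTorsion R) x := by
  have h := (hasDerivAt_smoothCutoff n (diskTorsion R x)).comp_hasFDerivAt x
    (hasFDerivAt_diskTorsion R x)
  ext j
  have h' : fderiv ℝ (fun x => smoothCutoff n (diskTorsion R x)) x = _ := h.fderiv
  rw [PiLp.smul_apply, grad_apply, grad_apply, h', (hasFDerivAt_diskTorsion R x).fderiv]
  rfl

theorem diskTorsion_pos {R : ℝ} {x : Plane} (hx : x ∈ Metric.ball (0 : Plane) R) :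
    0 < diskTorsion R x := by
  rw [mem_ball_zero_iff] at hx
  have := norm_nonneg x
  rw [diskTorsion]
  nlinarith

/-- The approximants truncate the torsion function near its zero level. At each point of the disk
they and their gradients eventually agree with it, and both are bounded uniformly in n, so dominated
convergence gives H¹ convergence. -/
theorem memH10_diskTorsion {R : ℝ} (hR : 0 < R) :
    MemH10 (Metric.ball (0 : Plane) R) (diskTorsion R) (grad (diskTorsion R)) := by
  have hψ := contDiff_diskTorsion R
  have hψ1 : ContDiff ℝ 1 (diskTorsion R) := hψ.of_le (by exact_mod_cast le_top)
  have hgc := continuous_grad hψ1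
  have := isFiniteMeasure_restrict_ball R
  obtain ⟨C, hC⟩ := exists_abs_smoothCutoffDeriv_le
  refine ⟨⟨hψ.continuous.memLp_restrict_ball 2 R, hgc.memLp_restrict_ball 2 R,
    isWeakGradient_grad hψ1 _⟩, fun n x => smoothCutoff n (diskTorsion R x),
    isTestFunction_smoothCutoff hR, ?_, ?_⟩
  · refine tendsto_eLpNorm_two_of_bounded (C := R ^ 2) (fun n => ?_) (fun n => ?_) ?_
    · exact (((contDiff_smoothCutoff n).continuous.comp hψ.continuous).sub
        hψ.continuous).aestronglyMeasurable
    · refine (ae_restrict_iff' measurableSet_ball).2 (Eventually.of_forall fun x hx => ?_)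
      have h0 := diskTorsion_pos hx
      have h1 : diskTorsion R x ≤ R ^ 2 := by
        rw [diskTorsion]
        nlinarith [sq_nonneg ‖x‖]
      have h2 := Real.smoothTransition.nonneg (((n : ℝ) + 1) * diskTorsion R x - 1)
      have h3 := Real.smoothTransition.le_one (((n : ℝ) + 1) * diskTorsion R x - 1)
      change ‖smoothCutoff n (diskTorsion R x) - diskTorsion R x‖ ≤ R ^ 2
      rw [smoothCutoff, Real.norm_eq_abs, abs_le]
      constructor <;> nlinarith
    · refine (ae_restrict_iff' measurableSet_ball).2 (Eventually.of_forall fun x hx => ?_)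
      refine tendsto_const_nhds.congr' ?_
      filter_upwards [eventually_one_lt_mul_sub (diskTorsion_pos hx)] with n hn
      rw [smoothCutoff, Real.smoothTransition.one_of_one_le hn.le, mul_one, sub_self]
  · refine tendsto_eLpNorm_two_of_bounded (C := (C + 1) * R) (fun n => ?_) (fun n => ?_) ?_
    · refine ((continuous_grad ?_).sub hgc).aestronglyMeasurable
      exact ((contDiff_smoothCutoff n).comp hψ).of_le (by exact_mod_cast le_top)
    · refine (ae_restrict_iff' measurableSet_ball).2 (Eventually.of_forall fun x hx => ?_)
      have hn : ‖grad (diskTorsion R) x‖ ≤ R := by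
        rw [grad_diskTorsion, norm_smul]
        rw [mem_ball_zero_iff] at hx
        norm_num
        linarith
      have hc := hC (((n : ℝ) + 1) * diskTorsion R x - 1)
      have hC0 : 0 ≤ C := (abs_nonneg _).trans hc
      rw [grad_smoothCutoff_diskTorsion]
      refine (norm_sub_le _ _).trans ?_
      rw [norm_smul, add_one_mul C R, Real.norm_eq_abs]
      exact add_le_add (mul_le_mul hc hn (norm_nonneg _) hC0) hn
    · refine (ae_restrict_iff' measurableSet_ball).2 (Eventually.of_forall fun x hx => ?_)
      refine tendsto_const_nhds.congr' ?_
      filter_upwards [eventually_one_lt_mul_sub (diskTorsion_pos hx)] with n hn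
      rw [grad_smoothCutoff_diskTorsion, smoothCutoffDeriv_of_one_lt hn, one_smul, sub_self]

theorem isTorsionFunction_diskTorsion {R : ℝ} (hR : 0 < R) :
    IsTorsionFunction (Metric.ball (0 : Plane) R) (diskTorsion R) (grad (diskTorsion R)) := by
  refine ⟨memH10_diskTorsion hR, fun φ hφ => ?_⟩
  have hφ1 : ContDiff ℝ 1 φ := hφ.1.of_le (by exact_mod_cast le_top)
  -- As the gradient of the torsion function is -x/2, the weak equation follows by integrating by
  -- parts against each coordinate function; the two coordinates cancel the factor 1/2.
  have hcoord : ∀ j : Fin 2, ∫ x in Metric.ball (0 : Plane) R, grad φ x j * x j =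
      -∫ x in Metric.ball (0 : Plane) R, φ x := by
    intro j
    have hc : ContDiff ℝ 1 fun x : Plane => x j := (EuclideanSpace.proj j : Plane →L[ℝ] ℝ).contDiff
    have h := isWeakGradient_grad hc (Metric.ball (0 : Plane) R) φ hφ j
    have hg : ∀ x : Plane, grad (fun x : Plane => x j) x j = 1 := by
      intro x
      rw [grad_apply]
      have : fderiv ℝ (fun x : Plane => x j) x = EuclideanSpace.proj j :=
        (EuclideanSpace.proj j : Plane →L[ℝ] ℝ).fderiv
      rw [this]
      simp
    simpa [hg] using h
  have hint : ∀ j : Fin 2, IntegrableOn (fun x : Plane => grad φ x j * x j)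
      (Metric.ball (0 : Plane) R) := by
    intro j
    have hc : Continuous fun x : Plane => grad φ x j * x j :=
      ((EuclideanSpace.proj j).continuous.comp (continuous_grad hφ1)).mul
        (EuclideanSpace.proj j).continuous
    exact memLp_one_iff_integrable.1 (hc.memLp_restrict_ball 1 R)
  have e : ∀ x : Plane, inner ℝ (grad (diskTorsion R) x) (grad φ x) =
      -(1 / 2 : ℝ) * (grad φ x 0 * x 0 + grad φ x 1 * x 1) := by
    intro x
    rw [grad_diskTorsion]
    simp only [PiLp.inner_apply, Fin.sum_univ_two, PiLp.smul_apply]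
    simp
    ring
  simp only [e]
  rw [integral_const_mul, integral_add (hint 0) (hint 1), hcoord 0, hcoord 1]
  ring

/-- The difference of the two gradients is L²-orthogonal to gradients of test functions, hence to
their limits `G₁` and `G₂`, hence to itself. This identifies the gradient picked by choice in
`torsion` with the explicit one. -/
theorem IsTorsionFunction.ae_eq {Ω : Set Plane} {ψ₁ ψ₂ : Plane → ℝ} {G₁ G₂ : Plane → Plane}
    (h₁ : IsTorsionFunction Ω ψ₁ G₁) (h₂ : IsTorsionFunction Ω ψ₂ G₂) :
    G₁ =ᵐ[volume.restrict Ω] G₂ := by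
  obtain ⟨⟨⟨-, m₁, -⟩, φ₁, t₁, -, l₁⟩, e₁⟩ := h₁
  obtain ⟨⟨⟨-, m₂, -⟩, φ₂, t₂, -, l₂⟩, e₂⟩ := h₂
  have memLp_grad : ∀ φ : Plane → ℝ, IsTestFunction Ω φ →
      MemLp (grad φ) 2 (volume.restrict Ω) := fun φ hφ =>
    ((continuous_grad (hφ.1.of_le (by exact_mod_cast le_top))).memLp_of_hasCompactSupport
      (hasCompactSupport_grad hφ.2.1)).restrict Ω
  have inner_toLp : ∀ {G : Plane → Plane} (m : MemLp G 2 (volume.restrict Ω))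
      (φ : Plane → ℝ) (hφ : IsTestFunction Ω φ),
      inner ℝ (m.toLp G) ((memLp_grad φ hφ).toLp (grad φ)) =
        ∫ x in Ω, inner ℝ (G x) (grad φ x) := by
    intro G m φ hφ
    rw [L2.inner_def]
    refine integral_congr_ae ?_
    filter_upwards [m.coeFn_toLp, (memLp_grad φ hφ).coeFn_toLp] with x h1 h2
    rw [h1, h2]
  set H := m₁.toLp G₁ - m₂.toLp G₂ with hH
  have orth : ∀ (φ : Plane → ℝ) (hφ : IsTestFunction Ω φ),
      inner ℝ H ((memLp_grad φ hφ).toLp (grad φ)) = 0 := by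
    intro φ hφ
    rw [hH, inner_sub_left, inner_toLp m₁ φ hφ, inner_toLp m₂ φ hφ, e₁ φ hφ, e₂ φ hφ, sub_self]
  have orth_lim : ∀ {G : Plane → Plane} (m : MemLp G 2 (volume.restrict Ω))
      (φ : ℕ → Plane → ℝ), (∀ n, IsTestFunction Ω (φ n)) →
      Tendsto (fun n => eLpNorm (fun x => grad (φ n) x - G x) 2 (volume.restrict Ω)) atTop (𝓝 0) →
      inner ℝ H (m.toLp G) = 0 := by
    intro G m φ t l
    have hl : Tendsto (fun n => (memLp_grad (φ n) (t n)).toLp (grad (φ n))) atTop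
        (𝓝 (m.toLp G)) :=
      (Lp.tendsto_Lp_iff_tendsto_eLpNorm'' _ (fun n => memLp_grad (φ n) (t n)) G m).2 l
    have h2 := (tendsto_const_nhds (x := H)).inner (𝕜 := ℝ) hl
    exact tendsto_nhds_unique (h2.congr fun n => orth (φ n) (t n)) tendsto_const_nhds
  have hzero : inner ℝ H H = 0 := by
    conv_lhs => rw [hH, inner_sub_right, ← hH]
    rw [orth_lim m₁ φ₁ t₁ l₁, orth_lim m₂ φ₂ t₂ l₂, sub_self]
  have hHz : H = 0 := inner_self_eq_zero.1 hzero
  exact (MemLp.toLp_eq_toLp_iff m₁ m₂).1 (sub_eq_zero.1 hHz)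

/-- The vector potential of the disk, `(-x₂ / 2, x₁ / 2)`. -/
noncomputable def diskPotential (x : Plane) : Plane := !₂[-x 1 / 2, x 0 / 2]

theorem vectorPotential_ball_ae {R : ℝ} (hR : 0 < R) :
    vectorPotential (Metric.ball (0 : Plane) R) =ᵐ[volume.restrict (Metric.ball (0 : Plane) R)]
      diskPotential := by
  have hT := isTorsionFunction_diskTorsion hR
  have hspec : IsTorsionFunction (Metric.ball (0 : Plane) R) (torsion (Metric.ball 0 R)).1
      (torsion (Metric.ball 0 R)).2 :=
    Classical.epsilon_spec (p := fun p : (Plane → ℝ) × (Plane → Plane) =>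
      IsTorsionFunction (Metric.ball (0 : Plane) R) p.1 p.2) ⟨(_, _), hT⟩
  filter_upwards [hspec.ae_eq hT] with x hx
  rw [vectorPotential, hx, grad_diskTorsion, diskPotential]
  ext j
  fin_cases j
  · simp
    ring
  · simp
    ring

/-! ### The magnetic Steklov inequality for smooth functions on a disk -/

/-- The magnetic gradient of a function `u` with gradient `G` for the potential `diskPotential`. -/
noncomputable def diskMagneticGradient (b : ℝ) (u : Plane → ℂ)
    (G : Plane → EuclideanSpace ℂ (Fin 2)) (x : Plane) : EuclideanSpace ℂ (Fin 2) :=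
  WithLp.toLp 2 fun j => -Complex.I * G x j - (b : ℂ) * (diskPotential x j : ℂ) * u x

theorem diskMagneticGradient_apply (b : ℝ) (u : Plane → ℂ)
    (G : Plane → EuclideanSpace ℂ (Fin 2)) (x : Plane) (j : Fin 2) :
    diskMagneticGradient b u G x j =
      -Complex.I * G x j - (b : ℂ) * (diskPotential x j : ℂ) * u x := rfl

theorem continuous_diskPotential_apply (j : Fin 2) :
    Continuous fun x : Plane => diskPotential x j := by
  unfold diskPotential
  fin_cases j
  · exact ((EuclideanSpace.proj 1 : Plane →L[ℝ] ℝ).continuous.neg).div_const 2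
  · exact ((EuclideanSpace.proj 0 : Plane →L[ℝ] ℝ).continuous).div_const 2

theorem continuous_diskMagneticGradient (b : ℝ) {φ : Plane → ℂ} (hφ : ContDiff ℝ 1 φ) :
    Continuous (diskMagneticGradient b φ (grad φ)) := by
  unfold diskMagneticGradient
  refine (PiLp.continuous_toLp 2 _).comp (continuous_pi fun j => ?_)
  refine Continuous.sub (continuous_const.mul ?_) (Continuous.mul (continuous_const.mul ?_) ?_)
  · exact (EuclideanSpace.proj j : EuclideanSpace ℂ (Fin 2) →L[ℂ] ℂ).continuous.comp
      (continuous_grad hφ)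
  · exact Complex.continuous_ofReal.comp (continuous_diskPotential_apply j)
  · exact hφ.continuous

/-- The radial derivative of `φ` in polar coordinates. -/
noncomputable def radialDeriv (φ : Plane → ℂ) (r θ : ℝ) : ℂ :=
  Real.cos θ * grad φ (polarPoint r θ) 0 + Real.sin θ * grad φ (polarPoint r θ) 1

/-- The angular derivative of `φ` in polar coordinates. -/
noncomputable def angularDeriv (φ : Plane → ℂ) (r θ : ℝ) : ℂ :=
  r * (-Real.sin θ * grad φ (polarPoint r θ) 0 + Real.cos θ * grad φ (polarPoint r θ) 1)

theorem polarPoint_eq (r θ : ℝ) :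
    polarPoint r θ = (r * Real.cos θ) • (EuclideanSpace.single 0 1 : Plane) +
      (r * Real.sin θ) • (EuclideanSpace.single 1 1 : Plane) := by
  ext j
  fin_cases j <;> simp

theorem hasDerivAt_radial {φ : Plane → ℂ} (hφ : ContDiff ℝ 1 φ) (r θ : ℝ) :
    HasDerivAt (fun r => φ (polarPoint r θ)) (radialDeriv φ r θ) r := by
  have h1 : HasDerivAt (fun r => polarPoint r θ)
      ((1 * Real.cos θ) • (EuclideanSpace.single 0 1 : Plane) +
        (1 * Real.sin θ) • (EuclideanSpace.single 1 1 : Plane)) r := by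
    simp only [polarPoint_eq]
    exact (((hasDerivAt_id r).mul_const _).smul_const _).add
      (((hasDerivAt_id r).mul_const _).smul_const _)
  have h2 := (hφ.differentiable one_ne_zero (polarPoint r θ)).hasFDerivAt.comp_hasDerivAt r h1
  refine h2.congr_deriv ?_
  rw [map_add, map_smul, map_smul, radialDeriv, grad_apply, grad_apply, Complex.real_smul,
    Complex.real_smul, one_mul, one_mul]

theorem hasDerivAt_angular {φ : Plane → ℂ} (hφ : ContDiff ℝ 1 φ) (r θ : ℝ) :
    HasDerivAt (fun θ => φ (polarPoint r θ)) (angularDeriv φ r θ) θ := by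
  have h1 : HasDerivAt (fun θ => polarPoint r θ)
      ((r * -Real.sin θ) • (EuclideanSpace.single 0 1 : Plane) +
        (r * Real.cos θ) • (EuclideanSpace.single 1 1 : Plane)) θ := by
    simp only [polarPoint_eq]
    exact (((Real.hasDerivAt_cos θ).const_mul _).smul_const _).add
      (((Real.hasDerivAt_sin θ).const_mul _).smul_const _)
  have h2 := (hφ.differentiable one_ne_zero (polarPoint r θ)).hasFDerivAt.comp_hasDerivAt θ h1
  refine h2.congr_deriv ?_
  rw [map_add, map_smul, map_smul, angularDeriv, grad_apply, grad_apply, Complex.real_smul,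
    Complex.real_smul]
  push_cast
  ring

theorem continuous_grad_polarPoint {φ : Plane → ℂ} (hφ : ContDiff ℝ 1 φ) (j : Fin 2) :
    Continuous fun p : ℝ × ℝ => grad φ (polarPoint p.1 p.2) j :=
  (EuclideanSpace.proj j : EuclideanSpace ℂ (Fin 2) →L[ℂ] ℂ).continuous.comp
    ((continuous_grad hφ).comp continuous_polarPoint)

theorem continuous_radialDeriv {φ : Plane → ℂ} (hφ : ContDiff ℝ 1 φ) :
    Continuous fun p : ℝ × ℝ => radialDeriv φ p.1 p.2 := by
  have h0 := continuous_grad_polarPoint hφ 0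
  have h1 := continuous_grad_polarPoint hφ 1
  unfold radialDeriv
  fun_prop

theorem continuous_angularDeriv {φ : Plane → ℂ} (hφ : ContDiff ℝ 1 φ) :
    Continuous fun p : ℝ × ℝ => angularDeriv φ p.1 p.2 := by
  have h0 := continuous_grad_polarPoint hφ 0
  have h1 := continuous_grad_polarPoint hφ 1
  unfold angularDeriv
  fun_prop

theorem norm_sq_rotate (θ : ℝ) (z w : ℂ) :
    ‖Real.cos θ * z + Real.sin θ * w‖ ^ 2 + ‖-Real.sin θ * z + Real.cos θ * w‖ ^ 2 =
      ‖z‖ ^ 2 + ‖w‖ ^ 2 := by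
  have h := Real.sin_sq_add_cos_sq θ
  simp only [Complex.sq_norm, Complex.normSq_apply, Complex.add_re, Complex.add_im, Complex.mul_re,
    Complex.mul_im, Complex.neg_re, Complex.neg_im, Complex.ofReal_re, Complex.ofReal_im]
  linear_combination (z.re ^ 2 + z.im ^ 2 + w.re ^ 2 + w.im ^ 2) * h

/-- Rotating the components by θ separates a radial part, free of the potential, from an angular
part carrying the tangential potential r/2. The factor r² keeps the identity free of division at the
origin. -/
theorem sq_mul_norm_diskMagneticGradient (b : ℝ) (φ : Plane → ℂ) (r θ : ℝ) :
    r ^ 2 * ‖diskMagneticGradient b φ (grad φ) (polarPoint r θ)‖ ^ 2 =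
      r ^ 2 * ‖radialDeriv φ r θ‖ ^ 2 +
        ‖-Complex.I * angularDeriv φ r θ - (b * r ^ 2 / 2 : ℝ) * φ (polarPoint r θ)‖ ^ 2 := by
  set M := diskMagneticGradient b φ (grad φ) (polarPoint r θ) with hM
  have hc : (Real.sin θ : ℂ) ^ 2 + (Real.cos θ : ℂ) ^ 2 = 1 := by
    exact_mod_cast Real.sin_sq_add_cos_sq θ
  have h0 : M 0 = -Complex.I * grad φ (polarPoint r θ) 0 -
      b * (-(r * Real.sin θ) / 2 : ℝ) * φ (polarPoint r θ) := rfl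
  have h1 : M 1 = -Complex.I * grad φ (polarPoint r θ) 1 -
      b * ((r * Real.cos θ) / 2 : ℝ) * φ (polarPoint r θ) := rfl
  have e1 : Real.cos θ * M 0 + Real.sin θ * M 1 = -Complex.I * radialDeriv φ r θ := by
    rw [h0, h1, radialDeriv]
    push_cast
    ring
  have e2 : r * (-Real.sin θ * M 0 + Real.cos θ * M 1) =
      -Complex.I * angularDeriv φ r θ - (b * r ^ 2 / 2 : ℝ) * φ (polarPoint r θ) := by
    rw [h0, h1, angularDeriv]
    push_cast at hc ⊢
    linear_combination -(b * r ^ 2 / 2 * φ (polarPoint r θ)) * hc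
  rw [EuclideanSpace.norm_sq_eq, Fin.sum_univ_two, ← norm_sq_rotate θ, mul_add, e1, ← e2, norm_mul,
    norm_neg, Complex.norm_I, one_mul, norm_mul, mul_pow, Complex.norm_real, Real.norm_eq_abs,
    sq_abs]

/-- A smooth function of `r` which equals `r w'(r) / w(r)` for `w(r) = I_0(b r² / 4)`. -/
noncomputable def riccati (b r : ℝ) : ℝ := r * profileDeriv b r / profile b r

/-- The Riccati form of the radial equation: (r h)' = b²r³/4 - r h² for h = w'/w. -/
theorem hasDerivAt_riccati (b r : ℝ) :
    HasDerivAt (riccati b)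
      (b ^ 2 * r ^ 3 / 4 - r * (profileDeriv b r / profile b r) ^ 2) r := by
  have h := (hasDerivAt_mul_profileDeriv b r).div (hasDerivAt_profile b r) (profile_pos b r).ne'
  refine h.congr_deriv ?_
  have := (profile_pos b r).ne'
  field_simp

theorem continuous_profile (b : ℝ) : Continuous (profile b) := (contDiff_profile b).continuous

theorem continuous_profileDeriv (b : ℝ) : Continuous (profileDeriv b) :=
  (contDiff_profileDeriv b).continuous

/-- Completion of the square: by the Riccati equation, the derivative of r h |v|² is the energy
integrand minus r |v' - h v|². The boundary term at 0 drops out because of the factor r. -/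
theorem integral_radial_eq (b R : ℝ) {v v' : ℝ → ℂ} (hv : ∀ r, HasDerivAt v (v' r) r)
    (hv' : Continuous v') :
    ∫ r in (0 : ℝ)..R, (r * ‖v' r‖ ^ 2 + b ^ 2 * r ^ 3 / 4 * ‖v r‖ ^ 2) =
      riccati b R * ‖v R‖ ^ 2 +
        ∫ r in (0 : ℝ)..R, r * ‖v' r - (profileDeriv b r / profile b r : ℝ) • v r‖ ^ 2 := by
  have hvc : Continuous v := continuous_iff_continuousAt.2 fun r => (hv r).continuousAt
  have hh : Continuous fun r => profileDeriv b r / profile b r :=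
    (continuous_profileDeriv b).div (continuous_profile b) fun r => (profile_pos b r).ne'
  have c1 : Continuous fun r : ℝ => r * ‖v' r‖ ^ 2 + b ^ 2 * r ^ 3 / 4 * ‖v r‖ ^ 2 := by fun_prop
  have c2 : Continuous fun r : ℝ =>
      r * ‖v' r - (profileDeriv b r / profile b r : ℝ) • v r‖ ^ 2 := by fun_prop
  have hd : ∀ r, HasDerivAt (fun r => riccati b r * ‖v r‖ ^ 2)
      ((r * ‖v' r‖ ^ 2 + b ^ 2 * r ^ 3 / 4 * ‖v r‖ ^ 2) -
        r * ‖v' r - (profileDeriv b r / profile b r : ℝ) • v r‖ ^ 2) r := by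
    intro r
    refine ((hasDerivAt_riccati b r).mul (hv r).norm_sq).congr_deriv ?_
    rw [norm_sub_sq_real, norm_smul, inner_smul_right, mul_pow, Real.norm_eq_abs, sq_abs,
      real_inner_comm (v r) (v' r), riccati]
    ring
  have h := intervalIntegral.integral_eq_sub_of_hasDerivAt (a := 0) (b := R) (fun r _ => hd r)
    ((c1.sub c2).intervalIntegrable _ _)
  rw [intervalIntegral.integral_sub (c1.intervalIntegrable _ _) (c2.intervalIntegrable _ _)] at h
  have h0 : riccati b 0 = 0 := by simp [riccati]
  rw [h0, zero_mul, sub_zero] at h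
  linarith

/-- The expected value `w'(R) / w(R)` of the lowest magnetic Steklov eigenvalue of the disk, where
`w(r) = I_0(b r² / 4)`. -/
noncomputable def diskEigenvalue (b R : ℝ) : ℝ := profileDeriv b R / profile b R

theorem diskEigenvalue_pos {b R : ℝ} (hb : 0 < b) (hR : 0 < R) : 0 < diskEigenvalue b R :=
  div_pos (profileDeriv_pos hb hR) (profile_pos b R)

theorem riccati_eq (b R : ℝ) : riccati b R = R * diskEigenvalue b R := by
  rw [riccati, diskEigenvalue, mul_div_assoc]

theorem polarPoint_neg_pi (r : ℝ) : polarPoint r (-Real.pi) = polarPoint r Real.pi := by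
  ext j
  fin_cases j <;> simp

/-- The spectral inequality on the circle of radius r, with a = br²/2, half of b r² ≤ 1. It acts on
the angular part only, and r⁻¹ a² = b²r³/4. -/
theorem integral_circle_le {b r : ℝ} (hb : 0 ≤ b) (hr : 0 < r) (hbr : b * r ^ 2 ≤ 1)
    {φ : Plane → ℂ} (hφ : ContDiff ℝ 1 φ) :
    ∫ θ in (-Real.pi)..Real.pi,
        (r * ‖radialDeriv φ r θ‖ ^ 2 + b ^ 2 * r ^ 3 / 4 * ‖φ (polarPoint r θ)‖ ^ 2) ≤
      ∫ θ in (-Real.pi)..Real.pi,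
        r * ‖diskMagneticGradient b φ (grad φ) (polarPoint r θ)‖ ^ 2 := by
  have c1 : Continuous fun θ => radialDeriv φ r θ :=
    Continuous.uncurry_left (f := radialDeriv φ) r (continuous_radialDeriv hφ)
  have c2 : Continuous fun θ => angularDeriv φ r θ :=
    Continuous.uncurry_left (f := angularDeriv φ) r (continuous_angularDeriv hφ)
  have c3 : Continuous fun θ => φ (polarPoint r θ) :=
    hφ.continuous.comp (Continuous.uncurry_left (f := polarPoint) r continuous_polarPoint)
  have hper : φ (polarPoint r (-Real.pi)) = φ (polarPoint r Real.pi) := by rw [polarPoint_neg_pi]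
  have ha : b * r ^ 2 / 2 ≤ 1 / 2 := by linarith
  have hsp := integral_sq_le_of_periodic (v := fun θ => φ (polarPoint r θ))
    (v' := fun θ => angularDeriv φ r θ) (fun θ => hasDerivAt_angular hφ r θ) c2 hper
    (a := b * r ^ 2 / 2) (by positivity) ha
  obtain ⟨W, hW⟩ : ∃ W : ℝ → ℝ, ∀ θ, W θ =
      ‖-Complex.I * angularDeriv φ r θ - (b * r ^ 2 / 2 : ℝ) * φ (polarPoint r θ)‖ ^ 2 :=
    ⟨_, fun _ => rfl⟩
  have cW : Continuous W := by
    rw [funext hW]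
    exact ((continuous_const.mul c2).sub (continuous_const.mul c3)).norm.pow 2
  have e : ∀ θ, r * ‖diskMagneticGradient b φ (grad φ) (polarPoint r θ)‖ ^ 2 =
      r * ‖radialDeriv φ r θ‖ ^ 2 + r⁻¹ * W θ := by
    intro θ
    have h := sq_mul_norm_diskMagneticGradient b φ r θ
    rw [← hW] at h
    refine mul_left_cancel₀ hr.ne' ?_
    linear_combination h - W θ * mul_inv_cancel₀ hr.ne'
  simp only [← hW] at hsp
  simp only [e]
  have i1 : IntervalIntegrable (fun θ => r * ‖radialDeriv φ r θ‖ ^ 2) volume (-Real.pi) Real.pi :=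
    (continuous_const.mul (c1.norm.pow 2)).intervalIntegrable _ _
  have i2 : IntervalIntegrable (fun θ => b ^ 2 * r ^ 3 / 4 * ‖φ (polarPoint r θ)‖ ^ 2) volume
      (-Real.pi) Real.pi := (continuous_const.mul (c3.norm.pow 2)).intervalIntegrable _ _
  have i3 : IntervalIntegrable (fun θ => r⁻¹ * W θ) volume (-Real.pi) Real.pi :=
    (continuous_const.mul cW).intervalIntegrable _ _
  rw [intervalIntegral.integral_add i1 i2, intervalIntegral.integral_add i1 i3,
    intervalIntegral.integral_const_mul (b ^ 2 * r ^ 3 / 4),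
    intervalIntegral.integral_const_mul r⁻¹]
  refine add_le_add le_rfl ?_
  calc b ^ 2 * r ^ 3 / 4 * ∫ θ in (-Real.pi)..Real.pi, ‖φ (polarPoint r θ)‖ ^ 2
      = r⁻¹ * ((b * r ^ 2 / 2) ^ 2 * ∫ θ in (-Real.pi)..Real.pi, ‖φ (polarPoint r θ)‖ ^ 2) := by
        field_simp
        ring
    _ ≤ r⁻¹ * ∫ θ in (-Real.pi)..Real.pi, W θ := mul_le_mul_of_nonneg_left hsp (by positivity)

/-- The radial identity bounds the boundary term ray by ray, Fubini exchanges the integrals, and the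
angular inequality is then applied circle by circle. -/
theorem diskEigenvalue_mul_integral_le {b R : ℝ} (hb : 0 ≤ b) (hR : 0 < R)
    (hbR : b * R ^ 2 ≤ 1) {φ : Plane → ℂ} (hφ : ContDiff ℝ 1 φ) :
    diskEigenvalue b R * ∫ x, ‖φ x‖ ^ 2 ∂(boundaryMeasure (Metric.ball (0 : Plane) R)) ≤
      ∫ x in Metric.ball (0 : Plane) R, ‖diskMagneticGradient b φ (grad φ) x‖ ^ 2 := by
  have cM := continuous_diskMagneticGradient b hφ
  have c1 := continuous_radialDeriv hφ
  have c3 : Continuous fun p : ℝ × ℝ => φ (polarPoint p.1 p.2) :=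
    hφ.continuous.comp continuous_polarPoint
  have c4 : Continuous fun p : ℝ × ℝ =>
      diskMagneticGradient b φ (grad φ) (polarPoint p.1 p.2) := cM.comp continuous_polarPoint
  obtain ⟨F, hF⟩ : ∃ F : ℝ → ℝ → ℝ, ∀ r θ, F r θ =
      r * ‖radialDeriv φ r θ‖ ^ 2 + b ^ 2 * r ^ 3 / 4 * ‖φ (polarPoint r θ)‖ ^ 2 :=
    ⟨_, fun _ _ => rfl⟩
  obtain ⟨G, hG⟩ : ∃ G : ℝ → ℝ → ℝ, ∀ r θ, G r θ =
      r * ‖diskMagneticGradient b φ (grad φ) (polarPoint r θ)‖ ^ 2 := ⟨_, fun _ _ => rfl⟩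
  have cF : Continuous (Function.uncurry F) := by
    simp only [Function.uncurry_def, hF]
    exact (continuous_fst.mul (c1.norm.pow 2)).add
      (((continuous_const.mul (continuous_fst.pow 3)).div_const 4).mul (c3.norm.pow 2))
  have cG : Continuous (Function.uncurry G) := by
    simp only [Function.uncurry_def, hG]
    exact continuous_fst.mul (c4.norm.pow 2)
  have cFs : Continuous (Function.uncurry fun θ r => F r θ) := cF.comp continuous_swap
  rw [integral_boundaryMeasure_ball hR (F := fun x => ‖φ x‖ ^ 2) (hφ.continuous.norm.pow 2),
    integral_ball_polar hR (F := fun x => ‖diskMagneticGradient b φ (grad φ) x‖ ^ 2)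
      (cM.norm.pow 2)]
  simp only [← hG]
  calc diskEigenvalue b R * (R * ∫ θ in (-Real.pi)..Real.pi, ‖φ (polarPoint R θ)‖ ^ 2)
      = ∫ θ in (-Real.pi)..Real.pi, riccati b R * ‖φ (polarPoint R θ)‖ ^ 2 := by
        rw [intervalIntegral.integral_const_mul, riccati_eq]
        ring
    _ ≤ ∫ θ in (-Real.pi)..Real.pi, ∫ r in (0 : ℝ)..R, F r θ := by
        refine intervalIntegral.integral_mono_on (neg_le_self Real.pi_pos.le) ?_ ?_ fun θ _ => ?_
        · have hc : Continuous fun θ : ℝ => φ (polarPoint R θ) :=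
            hφ.continuous.comp (Continuous.uncurry_left (f := polarPoint) R continuous_polarPoint)
          exact (continuous_const.mul (hc.norm.pow 2)).intervalIntegrable _ _
        · exact (intervalIntegral.continuous_parametric_intervalIntegral_of_continuous' cFs
            _ _).intervalIntegrable _ _
        · have cr : Continuous fun r : ℝ => radialDeriv φ r θ :=
            Continuous.uncurry_right (f := radialDeriv φ) θ c1
          simp only [hF]
          rw [integral_radial_eq b R (fun r => hasDerivAt_radial hφ r θ) cr]
          refine le_add_of_nonneg_right (intervalIntegral.integral_nonneg hR.le fun r hr => ?_)
          exact mul_nonneg hr.1 (sq_nonneg _)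
    _ = ∫ r in (0 : ℝ)..R, ∫ θ in (-Real.pi)..Real.pi, F r θ := by
        refine (MeasureTheory.intervalIntegral_intervalIntegral_swap ?_).symm
        refine IntegrableOn.mono_set (t := Set.uIcc 0 R ×ˢ Set.uIcc (-Real.pi) Real.pi)
          (cF.continuousOn.integrableOn_compact (isCompact_uIcc.prod isCompact_uIcc)) ?_
        exact Set.prod_mono Set.uIoc_subset_uIcc Set.uIoc_subset_uIcc
    _ ≤ ∫ r in (0 : ℝ)..R, ∫ θ in (-Real.pi)..Real.pi, G r θ := by
        refine intervalIntegral.integral_mono_on hR.le ?_ ?_ fun r hr => ?_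
        · exact (intervalIntegral.continuous_parametric_intervalIntegral_of_continuous' cF
            _ _).intervalIntegrable _ _
        · exact (intervalIntegral.continuous_parametric_intervalIntegral_of_continuous' cG
            _ _).intervalIntegrable _ _
        · simp only [hF, hG]
          -- At r = 0 both integrands vanish; the circle estimate needs r > 0.
          rcases hr.1.eq_or_lt with rfl | h0
          · simp
          · refine integral_circle_le hb h0 (le_trans ?_ hbR) hφ
            have := hr.2
            gcongr

/-- The radial function `I_0(b |x|² / 4)` on the plane. -/
noncomputable def groundState (b : ℝ) (x : Plane) : ℂ := (profile b ‖x‖ : ℂ)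

theorem contDiff_groundState (b : ℝ) : ContDiff ℝ ∞ (groundState b) :=
  Complex.ofRealCLM.contDiff.comp (contDiff_profile_norm b)

theorem groundState_polarPoint (b r θ : ℝ) : groundState b (polarPoint r θ) = profile b r := by
  have h : ‖polarPoint r θ‖ = |r| := by
    rw [EuclideanSpace.norm_eq, Fin.sum_univ_two, polarPoint_apply_zero, polarPoint_apply_one,
      Real.norm_eq_abs, Real.norm_eq_abs, sq_abs, sq_abs,
      show (r * Real.cos θ) ^ 2 + (r * Real.sin θ) ^ 2 =
        r ^ 2 * (Real.sin θ ^ 2 + Real.cos θ ^ 2) by ring,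
      Real.sin_sq_add_cos_sq, mul_one, Real.sqrt_sq_eq_abs]
  rw [groundState, h, profile, profile, Even.pow_abs (by decide)]

/-- Equality in both estimates: the function is constant on circles, and along rays v' = h v, so the
square vanishes. -/
theorem integral_diskMagneticGradient_groundState {b R : ℝ} (hR : 0 < R) :
    ∫ x in Metric.ball (0 : Plane) R,
        ‖diskMagneticGradient b (groundState b) (grad (groundState b)) x‖ ^ 2 =
      diskEigenvalue b R *
        ∫ x, ‖groundState b x‖ ^ 2 ∂(boundaryMeasure (Metric.ball (0 : Plane) R)) := by
  have hφ : ContDiff ℝ 1 (groundState b) :=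
    (contDiff_groundState b).of_le (by exact_mod_cast le_top)
  have hp : ∀ r, HasDerivAt (fun r => (profile b r : ℂ)) (profileDeriv b r : ℂ) r :=
    fun r => (hasDerivAt_profile b r).ofReal_comp
  have hrad : ∀ r θ, radialDeriv (groundState b) r θ = profileDeriv b r := by
    intro r θ
    have h := hasDerivAt_radial hφ r θ
    simp only [groundState_polarPoint] at h
    exact h.unique (hp r)
  have hang : ∀ r θ, angularDeriv (groundState b) r θ = 0 := by
    intro r θ
    have h := hasDerivAt_angular hφ r θ
    simp only [groundState_polarPoint] at h
    exact h.unique (hasDerivAt_const θ _)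
  have e : ∀ r θ, r * ‖diskMagneticGradient b (groundState b) (grad (groundState b))
        (polarPoint r θ)‖ ^ 2 =
      r * ‖(profileDeriv b r : ℂ)‖ ^ 2 + b ^ 2 * r ^ 3 / 4 * ‖(profile b r : ℂ)‖ ^ 2 := by
    intro r θ
    rcases eq_or_ne r 0 with rfl | hr
    · simp
    · have h := sq_mul_norm_diskMagneticGradient b (groundState b) r θ
      rw [hrad, hang, groundState_polarPoint, mul_zero, zero_sub, norm_neg, norm_mul, mul_pow,
        Complex.norm_real (b * r ^ 2 / 2), Real.norm_eq_abs, sq_abs] at h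
      refine mul_left_cancel₀ hr ?_
      linear_combination h
  rw [integral_ball_polar hR
      (F := fun x => ‖diskMagneticGradient b (groundState b) (grad (groundState b)) x‖ ^ 2)
      ((continuous_diskMagneticGradient b hφ).norm.pow 2),
    integral_boundaryMeasure_ball hR (F := fun x => ‖groundState b x‖ ^ 2)
      (hφ.continuous.norm.pow 2)]
  simp only [e, groundState_polarPoint, intervalIntegral.integral_const, smul_eq_mul]
  rw [intervalIntegral.integral_const_mul, integral_radial_eq b R hp (by
    exact Complex.continuous_ofReal.comp (continuous_profileDeriv b))]
  have hz : ∀ r, (profileDeriv b r : ℂ) - (profileDeriv b r / profile b r : ℝ) • (profile b r : ℂ)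
      = 0 := by
    intro r
    rw [Complex.real_smul, ← Complex.ofReal_mul, div_mul_cancel₀ _ (profile_pos b r).ne', sub_self]
  simp only [hz, norm_zero]
  rw [riccati_eq]
  simp
  ring

/-! ### The magnetic Steklov inequality on the Sobolev space of a disk -/

theorem eLpNorm_two_eq_ofReal_sqrt {α E : Type*} [MeasurableSpace α] {μ : Measure α}
    [NormedAddCommGroup E] {f : α → E} (hf : MemLp f 2 μ) :
    eLpNorm f 2 μ = ENNReal.ofReal (√(∫ x, ‖f x‖ ^ 2 ∂μ)) := by
  rw [hf.eLpNorm_eq_integral_rpow_norm two_ne_zero ENNReal.ofNat_ne_top, Real.sqrt_eq_rpow]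
  simp

/-- The vector potential `diskPotential`, with complex entries. -/
noncomputable def complexPotential (x : Plane) : EuclideanSpace ℂ (Fin 2) :=
  WithLp.toLp 2 fun j => (diskPotential x j : ℂ)

theorem continuous_complexPotential : Continuous complexPotential :=
  (PiLp.continuous_toLp 2 _).comp
    (continuous_pi fun j => Complex.continuous_ofReal.comp (continuous_diskPotential_apply j))

theorem norm_complexPotential_le (x : Plane) : ‖complexPotential x‖ ≤ ‖x‖ := by
  have h0 : complexPotential x 0 = ((-x 1 / 2 : ℝ) : ℂ) := rfl
  have h1 : complexPotential x 1 = ((x 0 / 2 : ℝ) : ℂ) := rfl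
  refine le_of_sq_le_sq ?_ (norm_nonneg _)
  rw [EuclideanSpace.norm_sq_eq, EuclideanSpace.norm_sq_eq, Fin.sum_univ_two, Fin.sum_univ_two, h0,
    h1, Complex.norm_real, Complex.norm_real]
  simp only [Real.norm_eq_abs, sq_abs]
  nlinarith [sq_nonneg (x 0), sq_nonneg (x 1)]

theorem diskMagneticGradient_eq (b : ℝ) (u : Plane → ℂ) (G : Plane → EuclideanSpace ℂ (Fin 2)) :
    diskMagneticGradient b u G =
      fun x => -Complex.I • G x - ((b : ℂ) * u x) • complexPotential x := by
  funext x
  ext j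
  rw [diskMagneticGradient_apply]
  simp only [PiLp.sub_apply, PiLp.smul_apply, smul_eq_mul, complexPotential]
  ring

theorem ae_norm_smul_complexPotential_le (b R : ℝ) (u : Plane → ℂ) :
    ∀ᵐ x ∂(volume.restrict (Metric.ball (0 : Plane) R)),
      ‖((b : ℂ) * u x) • complexPotential x‖ ≤ (|b| * R) * ‖u x‖ := by
  refine (ae_restrict_iff' measurableSet_ball).2 (Eventually.of_forall fun x hx => ?_)
  have h1 : ‖complexPotential x‖ ≤ R :=
    (norm_complexPotential_le x).trans (mem_ball_zero_iff.1 hx).le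
  rw [norm_smul, norm_mul, Complex.norm_real, Real.norm_eq_abs]
  calc |b| * ‖u x‖ * ‖complexPotential x‖ ≤ |b| * ‖u x‖ * R := by gcongr
    _ = |b| * R * ‖u x‖ := by ring

theorem memLp_diskMagneticGradient (b R : ℝ) {u : Plane → ℂ}
    {G : Plane → EuclideanSpace ℂ (Fin 2)}
    (hu : MemLp u 2 (volume.restrict (Metric.ball (0 : Plane) R)))
    (hG : MemLp G 2 (volume.restrict (Metric.ball (0 : Plane) R))) :
    MemLp (diskMagneticGradient b u G) 2 (volume.restrict (Metric.ball (0 : Plane) R)) := by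
  rw [diskMagneticGradient_eq]
  refine (hG.const_smul (-Complex.I)).sub (hu.of_le_mul ?_ (ae_norm_smul_complexPotential_le b R u))
  exact (hu.1.const_mul (b : ℂ)).smul continuous_complexPotential.aestronglyMeasurable

/-- The potential is bounded by R on the disk, so the magnetic gradient depends continuously, in L²,
on the function and its gradient. -/
theorem eLpNorm_diskMagneticGradient_sub_le (b R : ℝ) {u v : Plane → ℂ}
    {G H : Plane → EuclideanSpace ℂ (Fin 2)}
    (hu : MemLp u 2 (volume.restrict (Metric.ball (0 : Plane) R)))
    (hG : MemLp G 2 (volume.restrict (Metric.ball (0 : Plane) R)))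
    (hv : MemLp v 2 (volume.restrict (Metric.ball (0 : Plane) R)))
    (hH : MemLp H 2 (volume.restrict (Metric.ball (0 : Plane) R))) :
    eLpNorm (diskMagneticGradient b v H - diskMagneticGradient b u G) 2
        (volume.restrict (Metric.ball (0 : Plane) R)) ≤
      eLpNorm (fun x => H x - G x) 2 (volume.restrict (Metric.ball (0 : Plane) R)) +
        ENNReal.ofReal (|b| * R) *
          eLpNorm (fun x => v x - u x) 2 (volume.restrict (Metric.ball (0 : Plane) R)) := by
  have e : diskMagneticGradient b v H - diskMagneticGradient b u G =
      (-Complex.I • fun x => H x - G x) -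
        fun x => ((b : ℂ) * (v x - u x)) • complexPotential x := by
    rw [diskMagneticGradient_eq, diskMagneticGradient_eq]
    funext x
    simp only [Pi.sub_apply, Pi.smul_apply]
    module
  rw [e]
  refine (eLpNorm_sub_le ((hH.sub hG).1.const_smul _)
    (((hv.sub hu).1.const_mul (b : ℂ)).smul continuous_complexPotential.aestronglyMeasurable)
    one_le_two).trans ?_
  gcongr
  · have hI : ‖-Complex.I‖ₑ = 1 := by
      rw [← ofReal_norm, norm_neg, Complex.norm_I, ENNReal.ofReal_one]
    rw [eLpNorm_const_smul, hI, one_mul]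
    rfl
  · exact eLpNorm_le_mul_eLpNorm_of_ae_le_mul
      (ae_norm_smul_complexPotential_le b R fun x => v x - u x) 2

theorem _root_.Continuous.memLp_boundaryMeasure_ball {R : ℝ} (hR : 0 < R) {g : Plane → ℂ}
    (hg : Continuous g) : MemLp g 2 (boundaryMeasure (Metric.ball (0 : Plane) R)) := by
  have := isFiniteMeasure_boundaryMeasure_ball hR
  obtain ⟨C, hC⟩ := (isCompact_sphere (0 : Plane) R).exists_bound_of_continuousOn hg.continuousOn
  refine MemLp.of_bound hg.aestronglyMeasurable C ?_
  rw [boundaryMeasure, frontier_ball _ hR.ne']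
  exact (ae_restrict_iff' Metric.isClosed_sphere.measurableSet).2 (Eventually.of_forall hC)

/-- Taking square roots turns the quadratic inequality into one between L² norms. The triangle
inequality then moves it from the smooth functions defining the trace to the limit, with errors
tending to 0. -/
theorem diskEigenvalue_mul_le_of_isTrace {b R : ℝ} (hb : 0 < b) (hR : 0 < R) (hbR : b * R ^ 2 ≤ 1)
    {u : Plane → ℂ} {G : Plane → EuclideanSpace ℂ (Fin 2)} {g : Plane → ℂ}
    (hu : MemH1 (Metric.ball (0 : Plane) R) u G) (hg : IsTrace (Metric.ball (0 : Plane) R) u G g) :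
    diskEigenvalue b R * ∫ x, ‖g x‖ ^ 2 ∂(boundaryMeasure (Metric.ball (0 : Plane) R)) ≤
      ∫ x in Metric.ball (0 : Plane) R, ‖diskMagneticGradient b u G x‖ ^ 2 := by
  obtain ⟨hgm, φ, hφ, ⟨l₁, l₂⟩, l₃⟩ := hg
  obtain ⟨hum, hGm, -⟩ := hu
  set μ := volume.restrict (Metric.ball (0 : Plane) R)
  set σ := boundaryMeasure (Metric.ball (0 : Plane) R)
  set c := ENNReal.ofReal (√(diskEigenvalue b R))
  have hla := (diskEigenvalue_pos hb hR).le
  have hM := memLp_diskMagneticGradient b R hum hGm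
  have hφ1 : ∀ n, ContDiff ℝ 1 (φ n) := fun n => (hφ n).of_le (by exact_mod_cast le_top)
  have key : ∀ n, c * eLpNorm g 2 σ ≤ eLpNorm (diskMagneticGradient b u G) 2 μ +
      (eLpNorm (fun x => grad (φ n) x - G x) 2 μ +
        ENNReal.ofReal (|b| * R) * eLpNorm (fun x => φ n x - u x) 2 μ) +
      c * eLpNorm (fun x => φ n x - g x) 2 σ := by
    intro n
    have m1 : MemLp (φ n) 2 σ := (hφ1 n).continuous.memLp_boundaryMeasure_ball hR
    have m2 : MemLp (φ n) 2 μ := (hφ1 n).continuous.memLp_restrict_ball 2 R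
    have m3 : MemLp (grad (φ n)) 2 μ := (continuous_grad (hφ1 n)).memLp_restrict_ball 2 R
    have m4 := memLp_diskMagneticGradient b R m2 m3
    have s1 : c * eLpNorm (φ n) 2 σ ≤ eLpNorm (diskMagneticGradient b (φ n) (grad (φ n))) 2 μ := by
      rw [eLpNorm_two_eq_ofReal_sqrt m1, eLpNorm_two_eq_ofReal_sqrt m4,
        ← ENNReal.ofReal_mul (Real.sqrt_nonneg _), ← Real.sqrt_mul hla]
      exact ENNReal.ofReal_le_ofReal
        (Real.sqrt_le_sqrt (diskEigenvalue_mul_integral_le hb.le hR hbR (hφ1 n)))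
    have s2 : eLpNorm g 2 σ ≤ eLpNorm (φ n) 2 σ + eLpNorm (fun x => φ n x - g x) 2 σ := by
      have h := eLpNorm_sub_le m1.1 (m1.sub hgm).1 (p := 2) one_le_two
      rwa [sub_sub_cancel] at h
    have s3 : eLpNorm (diskMagneticGradient b (φ n) (grad (φ n))) 2 μ ≤
        eLpNorm (diskMagneticGradient b u G) 2 μ +
          eLpNorm (diskMagneticGradient b (φ n) (grad (φ n)) - diskMagneticGradient b u G) 2 μ := by
      have h := eLpNorm_add_le hM.1 (m4.sub hM).1 (p := 2) one_le_two
      rwa [add_sub_cancel] at h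
    have s4 := eLpNorm_diskMagneticGradient_sub_le b R hum hGm m2 m3
    calc c * eLpNorm g 2 σ
        ≤ c * eLpNorm (φ n) 2 σ + c * eLpNorm (fun x => φ n x - g x) 2 σ := by
          rw [← mul_add]
          gcongr
      _ ≤ _ := by
          gcongr
          exact s1.trans (s3.trans (by gcongr))
  have hlim : Tendsto (fun n => eLpNorm (diskMagneticGradient b u G) 2 μ +
      (eLpNorm (fun x => grad (φ n) x - G x) 2 μ +
        ENNReal.ofReal (|b| * R) * eLpNorm (fun x => φ n x - u x) 2 μ) +
      c * eLpNorm (fun x => φ n x - g x) 2 σ) atTop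
      (𝓝 (eLpNorm (diskMagneticGradient b u G) 2 μ +
        (0 + ENNReal.ofReal (|b| * R) * 0) + c * 0)) := by
    refine (tendsto_const_nhds.add (l₂.add (ENNReal.Tendsto.const_mul l₁ ?_))).add
      (ENNReal.Tendsto.const_mul l₃ ?_)
    · exact Or.inr ENNReal.ofReal_ne_top
    · exact Or.inr ENNReal.ofReal_ne_top
  simp only [mul_zero, add_zero] at hlim
  have hfin := ge_of_tendsto' hlim key
  rw [eLpNorm_two_eq_ofReal_sqrt hgm, eLpNorm_two_eq_ofReal_sqrt hM,
    ← ENNReal.ofReal_mul (Real.sqrt_nonneg _), ← Real.sqrt_mul hla,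
    ENNReal.ofReal_le_ofReal_iff (Real.sqrt_nonneg _)] at hfin
  exact (Real.sqrt_le_sqrt_iff (integral_nonneg fun _ => sq_nonneg _)).1 hfin

theorem rayleighQuotient_ball (b : ℝ) {R : ℝ} (hR : 0 < R) (u : Plane → ℂ)
    (G : Plane → EuclideanSpace ℂ (Fin 2)) (g : Plane → ℂ) :
    rayleighQuotient b (Metric.ball (0 : Plane) R) u G g =
      (∫ x in Metric.ball (0 : Plane) R, ‖diskMagneticGradient b u G x‖ ^ 2) /
        ∫ x, ‖g x‖ ^ 2 ∂(boundaryMeasure (Metric.ball (0 : Plane) R)) := by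
  rw [rayleighQuotient]
  congr 1
  refine integral_congr_ae ?_
  filter_upwards [vectorPotential_ball_ae hR] with x hx
  rw [magneticGradient, hx, diskMagneticGradient]

theorem integral_trace_pos {Ω : Set Plane} {u : Plane → ℂ} {G : Plane → EuclideanSpace ℂ (Fin 2)}
    {g : Plane → ℂ} (h : IsAdmissible Ω u G g) :
    0 < ∫ x, ‖g x‖ ^ 2 ∂(boundaryMeasure Ω) := by
  obtain ⟨-, ⟨hgm, -⟩, hne⟩ := h
  refine lt_of_le_of_ne (integral_nonneg fun _ => sq_nonneg _) fun h0 => hne ?_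
  have hi : Integrable (fun x => ‖g x‖ ^ 2) (boundaryMeasure Ω) :=
    hgm.integrable_norm_pow (p := 2) two_ne_zero
  have h1 := (integral_eq_zero_iff_of_nonneg (fun _ => sq_nonneg _) hi).1 h0.symm
  filter_upwards [h1] with x hx
  simpa using hx

theorem isAdmissible_groundState (b : ℝ) {R : ℝ} (hR : 0 < R) :
    IsAdmissible (Metric.ball (0 : Plane) R) (groundState b) (grad (groundState b))
      (groundState b) := by
  have hs := contDiff_groundState b
  have h1 : ContDiff ℝ 1 (groundState b) := hs.of_le (by exact_mod_cast le_top)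
  refine ⟨⟨h1.continuous.memLp_restrict_ball 2 R, (continuous_grad h1).memLp_restrict_ball 2 R,
    isWeakGradient_grad h1 _⟩, ⟨h1.continuous.memLp_boundaryMeasure_ball hR,
    -- The function is smooth on the whole plane, so a constant sequence witnesses its trace.
    fun _ => groundState b, fun _ => hs, ⟨?_, ?_⟩, ?_⟩, fun h0 => ?_⟩
  · simp
  · simp
  · simp
  · have hi := integral_boundaryMeasure_ball hR (F := fun x => ‖groundState b x‖ ^ 2)
      (h1.continuous.norm.pow 2)
    have hz : ∫ x, ‖groundState b x‖ ^ 2 ∂(boundaryMeasure (Metric.ball (0 : Plane) R)) = 0 := by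
      refine integral_eq_zero_of_ae ?_
      filter_upwards [h0] with x hx
      simp [hx]
    have hp := profile_pos b R
    rw [hz] at hi
    simp only [groundState_polarPoint, intervalIntegral.integral_const, smul_eq_mul,
      Complex.norm_real, Real.norm_eq_abs, sq_abs] at hi
    have hpi := Real.pi_pos
    have : 0 < R * ((Real.pi - -Real.pi) * profile b R ^ 2) := by
      rw [sub_neg_eq_add]
      positivity
    linarith

theorem rayleighQuotient_groundState (b : ℝ) {R : ℝ} (hR : 0 < R) :
    rayleighQuotient b (Metric.ball (0 : Plane) R) (groundState b) (grad (groundState b))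
      (groundState b) = diskEigenvalue b R := by
  rw [rayleighQuotient_ball b hR, integral_diskMagneticGradient_groundState hR,
    mul_div_cancel_right₀ _ (integral_trace_pos (isAdmissible_groundState b hR)).ne']

theorem steklovEigenvalue_ball {b R : ℝ} (hb : 0 < b) (hR : 0 < R) (hbR : b * R ^ 2 ≤ 1) :
    steklovEigenvalue b (Metric.ball (0 : Plane) R) = diskEigenvalue b R := by
  refine IsLeast.csInf_eq ⟨⟨_, _, _, isAdmissible_groundState b hR,
    (rayleighQuotient_groundState b hR).symm⟩, ?_⟩
  rintro _ ⟨u, G, g, h, rfl⟩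
  rw [rayleighQuotient_ball b hR, le_div_iff₀ (integral_trace_pos h)]
  exact diskEigenvalue_mul_le_of_isTrace hb hR hbR h.1 h.2.1

/-! ### The radial differential equation -/

theorem solvesRadialProblem_profile (b : ℝ) {R : ℝ} (hR : 0 < R) :
    SolvesRadialProblem b R (diskEigenvalue b R) fun r => (profile b r : ℂ) := by
  have hp : ∀ r, HasDerivAt (fun r => (profile b r : ℂ)) (profileDeriv b r : ℂ) r :=
    fun r => (hasDerivAt_profile b r).ofReal_comp
  have hd : deriv (fun r => (profile b r : ℂ)) = fun r => (profileDeriv b r : ℂ) :=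
    funext fun r => (hp r).deriv
  refine ⟨(Complex.ofRealCLM.contDiff.comp (contDiff_profile b)).contDiffOn, fun r hr => ?_, ?_⟩
  · have h1 : HasDerivAt (profileDeriv b) (deriv (profileDeriv b) r) r :=
      ((contDiff_profileDeriv b).differentiable (by simp) r).hasDerivAt
    have h2 := ((hasDerivAt_id r).mul h1).unique (hasDerivAt_mul_profileDeriv b r)
    simp only [id, one_mul] at h2
    have hr0 : (r : ℂ) ≠ 0 := by exact_mod_cast hr.1.ne'
    have h3 : (profileDeriv b r : ℂ) + r * (deriv (profileDeriv b) r : ℝ) =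
        b ^ 2 * r ^ 3 / 4 * profile b r := by exact_mod_cast h2
    rw [hd, h1.ofReal_comp.deriv]
    field_simp
    linear_combination -4 * h3
  · rw [(hp R).hasDerivWithinAt.derivWithin (uniqueDiffOn_Icc hR R (Set.right_mem_Icc.2 hR.le)),
      ← Complex.ofReal_mul, diskEigenvalue, div_mul_cancel₀ _ (profile_pos b R).ne']

theorem eq_of_hasDerivAt_zero_on_Ioo {F : ℝ → ℂ} {R : ℝ} (hc : ContinuousOn F (Set.Icc 0 R))
    (hd : ∀ r ∈ Set.Ioo 0 R, HasDerivAt F 0 r) : ∀ r ∈ Set.Icc 0 R, F r = F 0 := by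
  intro r hr
  have h := intervalIntegral.integral_eq_sub_of_hasDerivAt_of_le hr.1
    (hc.mono (Set.Icc_subset_Icc_right hr.2)) (f' := fun _ => 0)
    (fun x hx => hd x ⟨hx.1, hx.2.trans_le hr.2⟩) (by simp)
  rw [intervalIntegral.integral_zero] at h
  exact sub_eq_zero.1 h.symm

/-- Smoothness up to r = 0 excludes the second, singular solution: the constant r(f'w - fw') must be
0, so (f/w)' = 0. -/
theorem SolvesRadialProblem.eq_mul_profile {b R μ : ℝ} (hR : 0 < R) {f : ℝ → ℂ}
    (hf : SolvesRadialProblem b R μ f) :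
    ∃ A : ℂ, ∀ r ∈ Set.Icc 0 R, f r = A * profile b r := by
  obtain ⟨hs, hode, -⟩ := hf
  have hu : UniqueDiffOn ℝ (Set.Icc 0 R) := uniqueDiffOn_Icc hR
  -- The one-sided derivative is continuous up to both endpoints and agrees with `deriv f` inside;
  -- continuity at 0 is what makes the Wronskian vanish there.
  set g := derivWithin f (Set.Icc 0 R) with hg
  have hgs : ContDiffOn ℝ ∞ g (Set.Icc 0 R) := ((contDiffOn_infty_iff_derivWithin hu).1 hs).2
  have hfd : ∀ r ∈ Set.Ioo 0 R, HasDerivAt f (g r) r := fun r hr =>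
    ((hs.differentiableOn (by simp)) r
      (Set.Ioo_subset_Icc_self hr)).hasDerivWithinAt.hasDerivAt (Icc_mem_nhds hr.1 hr.2)
  have hgd : ∀ r ∈ Set.Ioo 0 R, HasDerivAt g (deriv g r) r := fun r hr =>
    (((hgs.differentiableOn (by simp)) r
      (Set.Ioo_subset_Icc_self hr)).differentiableAt (Icc_mem_nhds hr.1 hr.2)).hasDerivAt
  have hp : ∀ r, HasDerivAt (fun r => (profile b r : ℂ)) (profileDeriv b r : ℂ) r :=
    fun r => (hasDerivAt_profile b r).ofReal_comp
  have hp0 : ∀ r, (profile b r : ℂ) ≠ 0 := fun r => by exact_mod_cast (profile_pos b r).ne'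
  have hpc : Continuous fun r => (profile b r : ℂ) :=
    Complex.continuous_ofReal.comp (continuous_profile b)
  have hqc : Continuous fun r => ((r * profileDeriv b r : ℝ) : ℂ) :=
    Complex.continuous_ofReal.comp (continuous_id.mul (continuous_profileDeriv b))
  have hode' : ∀ r ∈ Set.Ioo 0 R, g r + r * deriv g r = b ^ 2 * r ^ 3 / 4 * f r := by
    intro r hr
    have he : deriv f =ᶠ[𝓝 r] g := by
      filter_upwards [Ioo_mem_nhds hr.1 hr.2] with s hs'
      exact (hfd s hs').deriv
    have h := hode r hr
    rw [he.deriv_eq, he.eq_of_nhds] at h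
    have hr0 : (r : ℂ) ≠ 0 := by exact_mod_cast hr.1.ne'
    have h1 : (r : ℂ) * (1 / r) = 1 := mul_one_div_cancel hr0
    linear_combination -(r : ℂ) * h - g r * h1
  have hwronskian : ∀ r ∈ Set.Icc 0 R,
      (r : ℂ) * g r * profile b r - f r * ((r * profileDeriv b r : ℝ) : ℂ) = 0 := by
    intro r hr
    have h := eq_of_hasDerivAt_zero_on_Ioo (R := R)
      (F := fun r : ℝ => (r : ℂ) * g r * profile b r - f r * ((r * profileDeriv b r : ℝ) : ℂ))
      (((Complex.continuous_ofReal.continuousOn.mul hgs.continuousOn).mul hpc.continuousOn).sub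
        (hs.continuousOn.mul hqc.continuousOn)) ?_ r hr
    · simpa using h
    · intro s hs'
      have hid : HasDerivAt (fun r : ℝ => (r : ℂ)) 1 s := by
        simpa using (hasDerivAt_id s).ofReal_comp
      have h1 := ((hid.mul (hgd s hs')).mul (hp s)).sub
        ((hfd s hs').mul (hasDerivAt_mul_profileDeriv b s).ofReal_comp)
      refine h1.congr_deriv ?_
      have h2 := hode' s hs'
      simp only [Pi.mul_apply]
      push_cast
      linear_combination (profile b s : ℂ) * h2
  refine ⟨f 0 / profile b 0, fun r hr => ?_⟩
  have h := eq_of_hasDerivAt_zero_on_Ioo (R := R) (F := fun r : ℝ => f r / profile b r)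
    (hs.continuousOn.div hpc.continuousOn fun r _ => hp0 r) ?_ r hr
  · rw [← h, div_mul_cancel₀ _ (hp0 r)]
  · intro s hs'
    refine ((hfd s hs').div (hp s) (hp0 s)).congr_deriv ?_
    have h2 := hwronskian s (Set.Ioo_subset_Icc_self hs')
    have hs0 : (s : ℂ) ≠ 0 := by exact_mod_cast hs'.1.ne'
    have h3 : g s * profile b s - f s * profileDeriv b s = 0 := by
      refine mul_left_cancel₀ hs0 ?_
      push_cast at h2
      linear_combination h2
    rw [h3, zero_div]

/-- The fundamental lemma of the calculus of variations, applied to each component of `G`. -/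
theorem IsWeakGradient.ae_eq_zero {R : ℝ} {u : Plane → ℂ} {G : Plane → EuclideanSpace ℂ (Fin 2)}
    (hu : ∀ x ∈ Metric.ball (0 : Plane) R, u x = 0)
    (hG : MemLp G 2 (volume.restrict (Metric.ball (0 : Plane) R)))
    (h : IsWeakGradient (Metric.ball (0 : Plane) R) u G) :
    ∀ᵐ x ∂(volume.restrict (Metric.ball (0 : Plane) R)), G x = 0 := by
  have := isFiniteMeasure_restrict_ball R
  have hj : ∀ j : Fin 2, ∀ᵐ x ∂(volume.restrict (Metric.ball (0 : Plane) R)), G x j = 0 := by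
    intro j
    have hGj : MemLp (fun x => G x j) 2 (volume.restrict (Metric.ball (0 : Plane) R)) :=
      (EuclideanSpace.proj j : EuclideanSpace ℂ (Fin 2) →L[ℂ] ℂ).comp_memLp' hG
    have hae := IsOpen.ae_eq_zero_of_integral_contDiff_smul_eq_zero
      (μ := volume.restrict (Metric.ball (0 : Plane) R)) Metric.isOpen_ball
      ((hGj.integrable one_le_two).locallyIntegrable.locallyIntegrableOn _)
      fun φ h1 h2 h3 => by
        have h4 := h φ ⟨h1, h2, h3⟩ j
        rw [setIntegral_congr_fun (g := fun _ => (0 : ℂ)) measurableSet_ball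
          (fun x hx => by simp [hu x hx]), integral_zero] at h4
        exact neg_eq_zero.1 h4.symm
    filter_upwards [hae, ae_restrict_mem measurableSet_ball] with x h5 h6
    exact h5 h6
  filter_upwards [hj 0, hj 1] with x h0 h1
  ext j
  fin_cases j
  · exact h0
  · exact h1

theorem rayleighQuotient_eq_zero (b : ℝ) {R : ℝ} (hR : 0 < R) {u : Plane → ℂ}
    {G : Plane → EuclideanSpace ℂ (Fin 2)} (g : Plane → ℂ)
    (hu : ∀ x ∈ Metric.ball (0 : Plane) R, u x = 0)
    (h : MemH1 (Metric.ball (0 : Plane) R) u G) :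
    rayleighQuotient b (Metric.ball (0 : Plane) R) u G g = 0 := by
  rw [rayleighQuotient_ball b hR, integral_eq_zero_of_ae, zero_div]
  filter_upwards [h.2.2.ae_eq_zero hu h.2.1, ae_restrict_mem measurableSet_ball] with x h1 h2
  simp [diskMagneticGradient_eq, h1, hu x h2]

theorem diskEigenvalue_eq (b R : ℝ) :
    diskEigenvalue b R =
      b * R / 2 * (besselI 1 (b * R ^ 2 / 4) / besselI 0 (b * R ^ 2 / 4)) := by
  rw [diskEigenvalue, profileDeriv_eq, profile_eq, mul_div_assoc]

theorem mul_sq_le_one_of_mul_volume_ball_lt_pi {b R : ℝ} (hR : 0 < R)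
    (h : b * volume.real (Metric.ball (0 : Plane) R) < Real.pi) : b * R ^ 2 ≤ 1 := by
  rw [measureReal_def, EuclideanSpace.volume_ball_fin_two, ENNReal.toReal_mul, ENNReal.toReal_pow,
    ENNReal.toReal_ofReal hR.le, ENNReal.toReal_ofReal Real.pi_pos.le, ← mul_assoc] at h
  have := Real.pi_pos
  by_contra hlt
  nlinarith [not_le.1 hlt]

end MagSteklov

/-! ### The proposition. -/

theorem proposition2p2 (b R : ℝ) (hb : 0 < b) (hR : 0 < R)
    (hbR : b * volume.real (Metric.ball (0 : MagSteklov.Plane) R) < Real.pi) :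
    (∃ f : ℝ → ℂ,
      MagSteklov.IsGroundState b (Metric.ball 0 R) (fun x => f ‖x‖) ∧
      MagSteklov.SolvesRadialProblem b R
        (MagSteklov.steklovEigenvalue b (Metric.ball 0 R)) f) ∧
    (∀ f : ℝ → ℂ,
      MagSteklov.IsGroundState b (Metric.ball 0 R) (fun x => f ‖x‖) →
      MagSteklov.SolvesRadialProblem b R
        (MagSteklov.steklovEigenvalue b (Metric.ball 0 R)) f →
      ∃ A : ℂ, A ≠ 0 ∧ ∀ r ∈ Set.Icc 0 R,
        f r = A * (MagSteklov.besselI 0 (b * r ^ 2 / 4) : ℂ)) ∧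
    MagSteklov.steklovEigenvalue b (Metric.ball 0 R) =
      b * R / 2 *
        (MagSteklov.besselI 1 (b * R ^ 2 / 4) / MagSteklov.besselI 0 (b * R ^ 2 / 4)) := by
  have hle := MagSteklov.mul_sq_le_one_of_mul_volume_ball_lt_pi hR hbR
  have hla := MagSteklov.steklovEigenvalue_ball hb hR hle
  rw [hla]
  refine ⟨⟨fun r => (MagSteklov.profile b r : ℂ), ?_,
    MagSteklov.solvesRadialProblem_profile b hR⟩, fun f hgs hf => ?_,
    MagSteklov.diskEigenvalue_eq b R⟩
  · refine ⟨MagSteklov.grad (MagSteklov.groundState b), MagSteklov.groundState b,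
      MagSteklov.isAdmissible_groundState b hR, ?_⟩
    rw [hla]
    exact MagSteklov.rayleighQuotient_groundState b hR
  · obtain ⟨A, hA⟩ := hf.eq_mul_profile hR
    refine ⟨A, ?_, fun r hr => by rw [hA r hr, MagSteklov.profile_eq]⟩
    -- For A = 0 the function vanishes on the disk, so its quotient is 0 whatever its trace `g`; but
    -- it attains the positive eigenvalue.
    rintro rfl
    obtain ⟨G, g, hadm, hq⟩ := hgs
    rw [hla, MagSteklov.rayleighQuotient_eq_zero b hR g (fun x hx => ?_) hadm.1] at hq
    · exact (MagSteklov.diskEigenvalue_pos hb hR).ne hq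
    · rw [hA ‖x‖ ⟨norm_nonneg x, (mem_ball_zero_iff.1 hx).le⟩, zero_mul]
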